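/- Let $\mathfrak v,\mathfrak z$ be finite-dimensional Euclidean spaces, $n=\dim\mathfrak v$, $m=\dim\mathfrak z$, and let $J$ be a representation on $\mathfrak v$ of the Clifford algebra of the quadratic form $q(z)=-\langle z,z\rangle$ on $\mathfrak z$ such that $\|J_zv\|=\|z\|\,\|v\|$ for all $z\in\mathfrak z$, $v\in\mathfrak v$. Define $[\cdot,\cdot]\colon\mathfrak v\times\mathfrak v\to\mathfrak z$ by $\langle[v,w],z\rangle=\langle J_zv,w\rangle$. The associated Damek–Ricci space is the half-space $S=\{(v,z,t)\in\mathfrak v\times\mathfrak z\times\mathbb R: t>0\}$ with the Riemannian metric $$\langle(v_1,z_1,t_1),(v_2,z_2,t_2)\rangle_{(\bar v,\bar z,\bar t)}=\frac1{\bar t}\langle v_1,v_2\rangle+\frac1{\bar t^2}\Big\langle z_1+\tfrac12[v_1,\bar v],z_2+\tfrac12[v_2,\bar v]\Big\rangle+\frac{t_1t_2}{\bar t^2}.$$ For $k\ge1$, $\mathbb C\mathbf H^k$ is the Damek–Ricci space with $\mathfrak v=\mathbb C^{k-1}$, $\mathfrak z=\mathbb R$, $J_zv=z\,\mathrm i\,v$,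 and $\mathbb R\mathbf H^k$ is the (degenerate) one with $\mathfrak v=\mathbb R^{k-1}$, $\mathfrak z=0$. "The Damek–Ricci space is $\mathbb C\mathbf H^k$" means that there are linear isometries $\mathfrak v\cong\mathbb C^{k-1}$ and $\mathfrak z\cong\mathbb R$ that intertwine the maps $J$. A real subspace $W\subseteq\mathbb C^{k-1}$ is totally real if $\mathrm iW\perp W$, and maximal totally real if it is maximal, with respect to inclusion, among such subspaces. A smooth function $F\colon S\to\mathbb R$ is transnormal if $\|\nabla F\|^2=b\circ F$ for some $C^2$ function $b\colon F(S)\to\mathbb R$, and isoparametric if, in addition, $\Delta F=a\circ F$ for some continuous function $a\colon F(S)\to\mathbb R$. Let $\mathfrak v=\mathfrak v_1\oplus\mathfrak v_2$ be an orthogonal decomposition with orthogonal projections $\Pi_1,\Pi_2$, and let $$F(v,z,t)=\frac{\left(t+\frac12\|\Pi_2v\|^2\right)^2+\left\|z-\frac12[\Pi_1v,\Pi_2v]\right\|^2}{t^2}\qquad((v,z,t)\in S).$$ (i) $F$ is transnormal if and only if $J_z\mathfrak v_1\subseteq\mathfrak v_2$ and $J_z\mathfrak v_2\subseteq\mathfrak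 v_1$ for all $z\in\mathfrak z$. (ii) Assume $m\neq0$, and $n\ne0$ or $m=1$. Then $F$ is isoparametric if and only if, for some $k\ge1$, the Damek–Ricci space is $\mathbb C\mathbf H^k$ and $\mathfrak v_1$ is a maximal totally real subspace of $\mathfrak v=\mathbb C^{k-1}$. In this case the set $N=\{(v,0,t)\in S: v\in\mathfrak v_1\}$ is the image of $\mathbb R\mathbf H^k$ under a map that preserves Riemannian distances, $F\ge1$, and for every $r\ge0$ the level set $\{F=\cosh^2r\}$ is the tube of radius $r$ about $N$, i.e. the set of points of $S$ at Riemannian distance $r$ from $N$. -/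

import Mathlib

open scoped InnerProductSpace ContDiff

noncomputable section

/-! ### Riemannian calculus on an open subset of a finite-dimensional vector space

A Riemannian metric on an open set of `E` is given as `g : E → E → E → ℝ`, where `g p X Y` is the
inner product of the tangent vectors `X`, `Y` at `p`. -/

namespace Riem

variable {E : Type*} [NormedAddCommGroup E] [NormedSpace ℝ E]
variable {ι : Type*} [Fintype ι] [DecidableEq ι]

/-- The matrix `g_{ij}` of the metric at `p` in the coordinates given by the basis `b`. -/
def gram (g : E → E → E → ℝ) (b : Module.Basis ι ℝ E) (p : E) : Matrix ι ι ℝ :=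
  Matrix.of fun i j => g p (b i) (b j)

/-- The gradient `∑ g^{ij} (∂_j F) ∂_i`. -/
def gradient (g : E → E → E → ℝ) (b : Module.Basis ι ℝ E) (F : E → ℝ) (p : E) : E :=
  ∑ i, (∑ j, (gram g b p)⁻¹ i j * fderiv ℝ F p (b j)) • b i

/-- The squared Riemannian length of the gradient. -/
def gradNormSq (g : E → E → E → ℝ) (b : Module.Basis ι ℝ E) (F : E → ℝ) (p : E) : ℝ :=
  g p (gradient g b F p) (gradient g b F p)

/-- The Riemannian volume density `√(det g_{ij})`. -/
def volDensity (g : E → E → E → ℝ) (b : Module.Basis ι ℝ E) (p : E) : ℝ :=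
  Real.sqrt (gram g b p).det

/-- The Laplace–Beltrami operator
`(det g)^{-1/2} ∑ ∂_i ((det g)^{1/2} (grad F)^i)`, the divergence of the gradient. -/
def laplacian (g : E → E → E → ℝ) (b : Module.Basis ι ℝ E) (F : E → ℝ) (p : E) : ℝ :=
  (volDensity g b p)⁻¹ *
    ∑ i, fderiv ℝ (fun q => volDensity g b q * b.repr (gradient g b F q) i) p (b i)

/-- A smooth function on `U` with `‖∇F‖² = β ∘ F` for a `C²` function `β` on the image of `F`. -/
def IsTransnormal (g : E → E → E → ℝ) (b : Module.Basis ι ℝ E) (U : Set E) (F : E → ℝ) : Prop :=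
  ContDiffOn ℝ ∞ F U ∧
    ∃ β : ℝ → ℝ, ContDiffOn ℝ 2 β (F '' U) ∧ ∀ p ∈ U, gradNormSq g b F p = β (F p)

/-- A transnormal function on `U` with `ΔF = α ∘ F` for a continuous function `α` on the image
of `F`. -/
def IsIsoparametric (g : E → E → E → ℝ) (b : Module.Basis ι ℝ E) (U : Set E) (F : E → ℝ) : Prop :=
  IsTransnormal g b U F ∧
    ∃ α : ℝ → ℝ, ContinuousOn α (F '' U) ∧ ∀ p ∈ U, laplacian g b F p = α (F p)

/-- The Riemannian length of a curve `[0,1] → E`. -/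
def curveLength (g : E → E → E → ℝ) (γ : ℝ → E) : ℝ :=
  ∫ s in (0 : ℝ)..1, Real.sqrt
    (g (γ s) (derivWithin γ (Set.Icc 0 1) s) (derivWithin γ (Set.Icc 0 1) s))

/-- The Riemannian distance in `U`: the infimum of the lengths of the `C¹` curves in `U` that
connect two points. -/
def dist (g : E → E → E → ℝ) (U : Set E) (p q : E) : ℝ :=
  sInf {L : ℝ | ∃ γ : ℝ → E, ContDiffOn ℝ 1 γ (Set.Icc 0 1) ∧ (∀ s ∈ Set.Icc (0 : ℝ) 1, γ s ∈ U) ∧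
    γ 0 = p ∧ γ 1 = q ∧ L = curveLength g γ}

/-- The tube of radius `r` about a non-empty subset `N` of `U`: the points of `U` at Riemannian
distance `r` from `N`. -/
def tube (g : E → E → E → ℝ) (U N : Set E) (r : ℝ) : Set E :=
  {p ∈ U | sInf ((fun q => dist g U p q) '' N) = r}

end Riem

/-! ### Damek–Ricci spaces in the half-space model -/

/-- The quadratic form `q(z) = -⟨z, z⟩`. -/
def negNormSqForm (Z : Type*) [NormedAddCommGroup Z] [InnerProductSpace ℝ Z] :
    QuadraticForm ℝ Z :=
  -(LinearMap.BilinMap.toQuadraticMap (innerₗ Z))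

theorem negNormSqForm_apply {Z : Type*} [NormedAddCommGroup Z] [InnerProductSpace ℝ Z] (z : Z) :
    negNormSqForm Z z = -⟪z, z⟫_ℝ := rfl

/-- The algebraic data of a Damek–Ricci space: a representation of the Clifford algebra
`Cl(Z, q)`, `q(z) = -⟨z, z⟩`, on `V` such that `‖J_z v‖ = ‖z‖ ‖v‖`. -/
structure DamekRicci (V Z : Type*) [NormedAddCommGroup V] [InnerProductSpace ℝ V]
    [NormedAddCommGroup Z] [InnerProductSpace ℝ Z] where
  rep : CliffordAlgebra (negNormSqForm Z) →ₐ[ℝ] Module.End ℝ V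
  norm_rep : ∀ (z : Z) (v : V), ‖rep (CliffordAlgebra.ι (negNormSqForm Z) z) v‖ = ‖z‖ * ‖v‖

namespace DamekRicci

section

variable {V Z : Type*} [NormedAddCommGroup V] [InnerProductSpace ℝ V]
  [NormedAddCommGroup Z] [InnerProductSpace ℝ Z]

/-- The map `z ↦ J_z`. -/
def J (D : DamekRicci V Z) : Z →ₗ[ℝ] V →ₗ[ℝ] V :=
  D.rep.toLinearMap ∘ₗ CliffordAlgebra.ι (negNormSqForm Z)

variable [FiniteDimensional ℝ V] [FiniteDimensional ℝ Z]

/-- The Lie bracket `V × V → Z`, see `inner_bracket`. -/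
def bracket (D : DamekRicci V Z) (x y : V) : Z :=
  LinearMap.adjoint (D.J.flip x) y

/-- The defining property `⟨[x, y], z⟩ = ⟨J_z x, y⟩` of the bracket. -/
theorem inner_bracket (D : DamekRicci V Z) (x y : V) (z : Z) :
    ⟪D.bracket x y, z⟫_ℝ = ⟪D.J z x, y⟫_ℝ := by
  rw [bracket, LinearMap.adjoint_inner_left, LinearMap.flip_apply, real_inner_comm]

/-- The left invariant metric of the Damek–Ricci space at the point `p = (v, z, t)` of the
half-space model. -/
def metric (D : DamekRicci V Z) (p X Y : V × Z × ℝ) : ℝ :=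
  1 / p.2.2 * ⟪X.1, Y.1⟫_ℝ +
    1 / p.2.2 ^ 2 * ⟪X.2.1 + (1 / 2 : ℝ) • D.bracket X.1 p.1,
      Y.2.1 + (1 / 2 : ℝ) • D.bracket Y.1 p.1⟫_ℝ +
    X.2.2 * Y.2.2 / p.2.2 ^ 2

end

/-- The half-space `{(v, z, t) : t > 0}`. -/
def halfSpace (V Z : Type*) : Set (V × Z × ℝ) := {p | 0 < p.2.2}

/-- Linear coordinates on `V × Z × ℝ` from orthonormal bases of `V` and `Z`. -/
def coords (V Z : Type*) [NormedAddCommGroup V] [InnerProductSpace ℝ V] [FiniteDimensional ℝ V]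
    [NormedAddCommGroup Z] [InnerProductSpace ℝ Z] [FiniteDimensional ℝ Z] :
    Module.Basis (Fin (Module.finrank ℝ V) ⊕ Fin (Module.finrank ℝ Z) ⊕ Unit) ℝ (V × Z × ℝ) :=
  (stdOrthonormalBasis ℝ V).toBasis.prod
    ((stdOrthonormalBasis ℝ Z).toBasis.prod (Module.Basis.singleton Unit ℝ))

/-- An isomorphism of the data of Damek–Ricci spaces. -/
structure Iso {V Z V' Z' : Type*} [NormedAddCommGroup V] [InnerProductSpace ℝ V]
    [NormedAddCommGroup Z] [InnerProductSpace ℝ Z] [NormedAddCommGroup V'] [InnerProductSpace ℝ V']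
    [NormedAddCommGroup Z'] [InnerProductSpace ℝ Z']
    (D : DamekRicci V Z) (D' : DamekRicci V' Z') where
  mapV : V ≃ₗᵢ[ℝ] V'
  mapZ : Z ≃ₗᵢ[ℝ] Z'
  map_J : ∀ (z : Z) (v : V), mapV (D.J z v) = D'.J (mapZ z) (mapV v)

/-- An isomorphism of the data induces an isometry `(v, z, t) ↦ (φ v, ψ z, t)` of the half-space
models. -/
theorem Iso.metric_eq {V Z V' Z' : Type*} [NormedAddCommGroup V] [InnerProductSpace ℝ V]
    [NormedAddCommGroup Z] [InnerProductSpace ℝ Z] [NormedAddCommGroup V'] [InnerProductSpace ℝ V']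
    [NormedAddCommGroup Z'] [InnerProductSpace ℝ Z'] [FiniteDimensional ℝ V]
    [FiniteDimensional ℝ Z] [FiniteDimensional ℝ V'] [FiniteDimensional ℝ Z']
    {D : DamekRicci V Z} {D' : DamekRicci V' Z'} (e : Iso D D') (p X Y : V × Z × ℝ) :
    D'.metric (e.mapV p.1, e.mapZ p.2.1, p.2.2) (e.mapV X.1, e.mapZ X.2.1, X.2.2)
      (e.mapV Y.1, e.mapZ Y.2.1, Y.2.2) = D.metric p X Y := by
  have hb : ∀ x y : V, D'.bracket (e.mapV x) (e.mapV y) = e.mapZ (D.bracket x y) := by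
    intro x y
    refine ext_inner_right ℝ fun w => ?_
    obtain ⟨z, rfl⟩ := e.mapZ.surjective w
    rw [inner_bracket, ← e.map_J, LinearIsometryEquiv.inner_map_map,
      LinearIsometryEquiv.inner_map_map, inner_bracket]
  simp only [metric, hb, ← map_smul, ← map_add, LinearIsometryEquiv.inner_map_map]

/-- Multiplication by the imaginary unit on `ℂ^d`. -/
def mulI (d : ℕ) : EuclideanSpace ℂ (Fin d) →ₗ[ℝ] EuclideanSpace ℂ (Fin d) :=
  (LinearMap.lsmul ℂ (EuclideanSpace ℂ (Fin d)) Complex.I).restrictScalars ℝ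

theorem mulI_apply (d : ℕ) (v : EuclideanSpace ℂ (Fin d)) : mulI d v = Complex.I • v := rfl

theorem mulI_aux (d : ℕ) (z : ℝ) :
    LinearMap.toSpanSingleton ℝ (Module.End ℝ (EuclideanSpace ℂ (Fin d))) (mulI d) z *
      LinearMap.toSpanSingleton ℝ (Module.End ℝ (EuclideanSpace ℂ (Fin d))) (mulI d) z =
      algebraMap ℝ _ (negNormSqForm ℝ z) := by
  refine LinearMap.ext fun v => ?_
  rw [Module.algebraMap_end_apply, negNormSqForm_apply]
  simp only [LinearMap.toSpanSingleton_apply, Module.End.mul_apply, LinearMap.smul_apply,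
    mulI_apply]
  ext i
  simp
  linear_combination (z : ℂ) ^ 2 * v i * Complex.I_sq

/-- The complex hyperbolic space `ℂH^k`, `k ≥ 1`, as a Damek–Ricci space: `V = ℂ^{k-1}`, `Z = ℝ`
and `J_z v = z i v`. -/
def complexHyperbolic (k : ℕ) : DamekRicci (EuclideanSpace ℂ (Fin (k - 1))) ℝ where
  rep := CliffordAlgebra.lift (negNormSqForm ℝ)
    ⟨LinearMap.toSpanSingleton ℝ (Module.End ℝ (EuclideanSpace ℂ (Fin (k - 1)))) (mulI (k - 1)),
      mulI_aux (k - 1)⟩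
  norm_rep z v := by
    rw [CliffordAlgebra.lift_ι_apply]
    simp [mulI_apply, norm_smul]

theorem complexHyperbolic_J (k : ℕ) (z : ℝ) (v : EuclideanSpace ℂ (Fin (k - 1))) :
    (complexHyperbolic k).J z v = z • Complex.I • v := by
  simp [J, complexHyperbolic, mulI_apply]

/-- The real hyperbolic space `ℝH^k`, `k ≥ 1`, as a degenerate Damek–Ricci space: `V = ℝ^{k-1}`
and `Z = 0`. -/
def realHyperbolic (k : ℕ) :
    DamekRicci (EuclideanSpace ℝ (Fin (k - 1))) (EuclideanSpace ℝ (Fin 0)) where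
  rep := CliffordAlgebra.lift (negNormSqForm (EuclideanSpace ℝ (Fin 0)))
    ⟨0, fun z => by rw [Subsingleton.elim z 0]; simp⟩
  norm_rep z v := by
    rw [Subsingleton.elim z 0]; simp

/-- A real subspace `W` of `ℂ^d` is totally real if `i W` is orthogonal to `W`. -/
def IsTotallyReal {d : ℕ} (W : Submodule ℝ (EuclideanSpace ℂ (Fin d))) : Prop :=
  ∀ x ∈ W, ∀ y ∈ W, ⟪Complex.I • x, y⟫_ℝ = 0

/-- `e` identifies the Damek–Ricci space `D` with `ℂH^k` so that `v₁` is a maximal totally real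
subspace of `V = ℂ^{k-1}`. -/
def IsMaximalTotallyReal {V Z : Type*} [NormedAddCommGroup V] [InnerProductSpace ℝ V]
    [NormedAddCommGroup Z] [InnerProductSpace ℝ Z] {D : DamekRicci V Z} {k : ℕ}
    (e : Iso D (complexHyperbolic k)) (v₁ : Submodule ℝ V) : Prop :=
  Maximal IsTotallyReal (v₁.map e.mapV.toLinearEquiv.toLinearMap)

section

variable {V Z : Type*} [NormedAddCommGroup V] [InnerProductSpace ℝ V] [FiniteDimensional ℝ V]
  [NormedAddCommGroup Z] [InnerProductSpace ℝ Z] [FiniteDimensional ℝ Z]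

/-- The function `F = ((t + ½‖Π₂ v‖²)² + ‖z - ½[Π₁ v, Π₂ v]‖²) / t²`. -/
def quarticF (D : DamekRicci V Z) (v₁ v₂ : Submodule ℝ V) (p : V × Z × ℝ) : ℝ :=
  ((p.2.2 + 1 / 2 * ‖v₂.starProjection p.1‖ ^ 2) ^ 2 +
    ‖p.2.1 - (1 / 2 : ℝ) • D.bracket (v₁.starProjection p.1) (v₂.starProjection p.1)‖ ^ 2) /
    p.2.2 ^ 2

/-- `F` is transnormal on the Damek–Ricci space. -/
def IsTransnormal (D : DamekRicci V Z) (F : V × Z × ℝ → ℝ) : Prop :=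
  Riem.IsTransnormal D.metric (coords V Z) (halfSpace V Z) F

/-- `F` is isoparametric on the Damek–Ricci space. -/
def IsIsoparametric (D : DamekRicci V Z) (F : V × Z × ℝ → ℝ) : Prop :=
  Riem.IsIsoparametric D.metric (coords V Z) (halfSpace V Z) F

/-- The Riemannian distance of the Damek–Ricci space. -/
def dist (D : DamekRicci V Z) (p q : V × Z × ℝ) : ℝ :=
  Riem.dist D.metric (halfSpace V Z) p q

/-- The tube of radius `r` about `N` in the Damek–Ricci space. -/
def tube (D : DamekRicci V Z) (N : Set (V × Z × ℝ)) (r : ℝ) : Set (V × Z × ℝ) :=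
  Riem.tube D.metric (halfSpace V Z) N r

/-- The subset `{(v, 0, t) : v ∈ W, t > 0}` of the half-space. -/
def slice (Z : Type*) [NormedAddCommGroup Z] (W : Submodule ℝ V) : Set (V × Z × ℝ) :=
  {p ∈ halfSpace V Z | p.1 ∈ W ∧ p.2.1 = 0}

/-- `N` is a copy of `ℝH^k` in the Damek–Ricci space: the image of `ℝH^k` under a map that
preserves the Riemannian distances of the two spaces. -/
def IsRealHyperbolicSubspace (D : DamekRicci V Z) (k : ℕ) (N : Set (V × Z × ℝ)) : Prop :=
  ∃ f : EuclideanSpace ℝ (Fin (k - 1)) × EuclideanSpace ℝ (Fin 0) × ℝ → V × Z × ℝ,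
    f '' halfSpace _ _ = N ∧
      ∀ p ∈ halfSpace _ _, ∀ q ∈ halfSpace _ _, D.dist (f p) (f q) = (realHyperbolic k).dist p q

end

end DamekRicci

end

set_option linter.unusedSectionVars false

noncomputable section

/-! ### Orthogonal decompositions -/

section Decomposition

variable {V : Type*} [NormedAddCommGroup V] [InnerProductSpace ℝ V]
  {v₁ v₂ : Submodule ℝ V}

/-! Write x = Π₁v, y = Π₂v, A = t + ½‖y‖², B = z - ½[x, y], n = dim V, m = dim Z, so that F = (A² +
‖B‖²)/t².

Transnormality. An explicit gradient gives ‖∇F‖² = 4F(F - 1) + t⁻³(‖Π₂J_B y‖² + ‖Π₁J_B(x + 2y)‖² -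
4‖B‖²‖y‖²) (`metric_gradF_self`). If every J_z interchanges v₁ and v₂, the defect in parentheses
vanishes. Conversely, on the axis v = 0 the defect vanishes and, if Z ≠ 0, F takes every value c ≥ 1
there. This forces b(c) = 4c(c - 1), so the defect vanishes everywhere, and its values at v ∈ v₁ and
v ∈ v₂ give the two inclusions (`swaps_of_isTransnormal`).

Isoparametricity. When J interchanges the summands and Z ≠ 0, dim v₁ = dim v₂ and the trace
computation `laplacian_quarticF` gives ΔF = (n + 2m + 4)F + (m - 1)‖y‖²/t - 4. If v₂ ≠ 0, comparison
of two points with the same F forces m = 1; if m = 1, ΔF is affine in F. For m = 1 a unit vector of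
Z acts as a complex structure, and the interchange condition says exactly that v₁ is maximal totally
real (`exists_iso_complexHyperbolic`, `swaps_of_isMaximalTotallyReal`).

Tubes. Put F = cosh²ρ. From ‖∇F‖² = 4F(F - 1), the function ρ is 1-Lipschitz, so ρ is at most the
distance to N = {F = 1} (`arsinh_le_curveLength`). An explicit curve from any point to N of length ρ
gives equality (`exists_dist_le`). Finally N is a distance-preserving copy of ℝH^k, because the
linear embedding and the orthogonal projection onto it are both non-expanding
(`isRealHyperbolicSubspace_slice`). -/

theorem Submodule.IsOrtho.orthogonal_eq_of_sup_eq_top (horth : v₁ ⟂ v₂) (hsum : v₁ ⊔ v₂ = ⊤) :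
    v₁ᗮ = v₂ := by
  refine le_antisymm (fun x hx => ?_) horth.symm.le
  obtain ⟨a, ha, b, hb, rfl⟩ := Submodule.mem_sup.1 (hsum ▸ Submodule.mem_top (x := x))
  have h : ⟪a, a⟫_ℝ = 0 := by
    have h₁ := (Submodule.mem_orthogonal _ _).1 hx a ha
    rwa [inner_add_right, horth.inner_eq ha hb, add_zero] at h₁
  rw [inner_self_eq_zero.1 h, zero_add]
  exact hb

theorem Submodule.IsOrtho.mem_of_forall_inner_eq_zero (horth : v₁ ⟂ v₂) (hsum : v₁ ⊔ v₂ = ⊤)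
    {y : V} (hy : ∀ x ∈ v₁, ⟪x, y⟫_ℝ = 0) : y ∈ v₂ := by
  rw [← horth.orthogonal_eq_of_sup_eq_top hsum]
  exact (Submodule.mem_orthogonal _ _).2 hy

variable [FiniteDimensional ℝ V]

theorem Submodule.IsOrtho.starProjection_add_starProjection (horth : v₁ ⟂ v₂)
    (hsum : v₁ ⊔ v₂ = ⊤) (v : V) : v₁.starProjection v + v₂.starProjection v = v := by
  obtain rfl := horth.orthogonal_eq_of_sup_eq_top hsum
  exact v₁.starProjection_add_starProjection_orthogonal v

theorem Submodule.IsOrtho.starProjection_eq_zero (horth : v₁ ⟂ v₂) {y : V} (hy : y ∈ v₂) :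
    v₁.starProjection y = 0 :=
  (Submodule.starProjection_apply_eq_zero_iff _).2 (horth.symm.le hy)

theorem Submodule.IsOrtho.finrank_add_finrank (horth : v₁ ⟂ v₂) (hsum : v₁ ⊔ v₂ = ⊤) :
    Module.finrank ℝ v₁ + Module.finrank ℝ v₂ = Module.finrank ℝ V := by
  rw [← horth.orthogonal_eq_of_sup_eq_top hsum]
  exact v₁.finrank_add_finrank_orthogonal

theorem Submodule.sum_inner_starProjection {ι : Type*} [Fintype ι] (b : OrthonormalBasis ι ℝ V)
    (W : Submodule ℝ V) : ∑ i, ⟪b i, W.starProjection (b i)⟫_ℝ = Module.finrank ℝ W := by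
  have h : LinearMap.IsProj W (W.starProjection : V →ₗ[ℝ] V) :=
    ⟨fun x => W.starProjection_apply_mem x, fun x hx => W.starProjection_eq_self_iff.2 hx⟩
  rw [← h.trace, LinearMap.trace_eq_sum_inner _ b]
  rfl

end Decomposition

/-! ### The Clifford action and the bracket -/

namespace DamekRicci

variable {V Z : Type*} [NormedAddCommGroup V] [InnerProductSpace ℝ V]
  [NormedAddCommGroup Z] [InnerProductSpace ℝ Z] (D : DamekRicci V Z)

theorem norm_J (z : Z) (v : V) : ‖D.J z v‖ = ‖z‖ * ‖v‖ := D.norm_rep z v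

theorem J_J (z : Z) (v : V) : D.J z (D.J z v) = -(‖z‖ ^ 2) • v := by
  have h := congrArg (fun a => D.rep a v) (CliffordAlgebra.ι_sq_scalar (negNormSqForm Z) z)
  simp only [map_mul, Module.End.mul_apply, AlgHom.commutes, Module.algebraMap_end_apply,
    negNormSqForm_apply, real_inner_self_eq_norm_sq] at h
  exact h

theorem inner_J_J (z : Z) (v w : V) : ⟪D.J z v, D.J z w⟫_ℝ = ‖z‖ ^ 2 * ⟪v, w⟫_ℝ := by
  have h : ∀ u, ⟪D.J z u, D.J z u⟫_ℝ = ‖z‖ ^ 2 * ⟪u, u⟫_ℝ := fun u => by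
    simp only [real_inner_self_eq_norm_sq, norm_J]; ring
  have h₁ := h (v + w)
  simp only [map_add, inner_add_left, inner_add_right, h, real_inner_comm v w,
    real_inner_comm (D.J z v) (D.J z w)] at h₁
  linarith

/-- For z ≠ 0 the map J_z is an isometry up to the factor ‖z‖ and squares to -‖z‖², hence is skew.
-/
theorem inner_J_left (z : Z) (v w : V) : ⟪D.J z v, w⟫_ℝ = -⟪v, D.J z w⟫_ℝ := by
  rcases eq_or_ne z 0 with rfl | hz
  · simp
  have h := D.inner_J_J z v (D.J z w)
  rw [J_J, inner_smul_right] at h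
  have hz' : ‖z‖ ^ 2 ≠ 0 := by simpa using hz
  apply mul_left_cancel₀ hz'
  linarith

theorem inner_J_self (z : Z) (v : V) : ⟪D.J z v, v⟫_ℝ = 0 := by
  have h := D.inner_J_left z v v
  rw [real_inner_comm (D.J z v) v] at h
  linarith

theorem inner_J_J_same (z w : Z) (v : V) : ⟪D.J z v, D.J w v⟫_ℝ = ⟪z, w⟫_ℝ * ‖v‖ ^ 2 := by
  have h : ∀ u, ⟪D.J u v, D.J u v⟫_ℝ = ⟪u, u⟫_ℝ * ‖v‖ ^ 2 := fun u => by
    simp only [real_inner_self_eq_norm_sq, norm_J]; ring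
  have h₁ := h (z + w)
  simp only [map_add, LinearMap.add_apply, inner_add_left, inner_add_right, h,
    real_inner_comm z w, real_inner_comm (D.J z v) (D.J w v)] at h₁
  linarith

/-- The condition that every `J_z` interchanges `v₁` and `v₂`. -/
abbrev Swaps (v₁ v₂ : Submodule ℝ V) : Prop :=
  (∀ z : Z, ∀ v ∈ v₁, D.J z v ∈ v₂) ∧ (∀ z : Z, ∀ v ∈ v₂, D.J z v ∈ v₁)

section Bracket

variable [FiniteDimensional ℝ V] [FiniteDimensional ℝ Z]

/-- The bracket as a continuous bilinear map. -/
def bracketL : V →L[ℝ] V →L[ℝ] Z :=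
  (LinearMap.mk₂ ℝ D.bracket
    (fun _ _ _ => ext_inner_right ℝ fun _ => by
      simp only [inner_bracket, inner_add_left, map_add])
    (fun _ _ _ => ext_inner_right ℝ fun _ => by
      simp only [inner_bracket, inner_smul_left, map_smul])
    (fun _ _ _ => ext_inner_right ℝ fun _ => by
      simp only [inner_bracket, inner_add_left, inner_add_right])
    (fun _ _ _ => ext_inner_right ℝ fun _ => by
      simp [inner_bracket, inner_smul_left, inner_smul_right])).toContinuousBilinearMap

theorem bracketL_apply (x y : V) : D.bracketL x y = D.bracket x y := rfl

/-- The Clifford action as a continuous bilinear map. -/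
def JL : Z →L[ℝ] V →L[ℝ] V := D.J.toContinuousBilinearMap

theorem JL_apply (z : Z) (v : V) : D.JL z v = D.J z v := rfl

theorem bracket_add_left (x x' y : V) : D.bracket (x + x') y = D.bracket x y + D.bracket x' y := by
  simp only [← bracketL_apply, map_add, _root_.add_apply]

theorem bracket_add_right (x y y' : V) :
    D.bracket x (y + y') = D.bracket x y + D.bracket x y' := by
  simp only [← bracketL_apply, map_add]

theorem bracket_smul_left (c : ℝ) (x y : V) : D.bracket (c • x) y = c • D.bracket x y := by
  simp only [← bracketL_apply, map_smul, _root_.smul_apply]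

theorem bracket_smul_right (c : ℝ) (x y : V) : D.bracket x (c • y) = c • D.bracket x y := by
  simp only [← bracketL_apply, map_smul]

theorem bracket_zero_left (y : V) : D.bracket 0 y = 0 := by
  simp only [← bracketL_apply, map_zero, _root_.zero_apply]

theorem bracket_zero_right (x : V) : D.bracket x 0 = 0 := by
  simp only [← bracketL_apply, map_zero]

theorem bracket_swap (x y : V) : D.bracket x y = -D.bracket y x :=
  ext_inner_right ℝ fun z => by
    rw [inner_neg_left, inner_bracket, inner_bracket, inner_J_left, real_inner_comm]

theorem inner_bracket_right (x y : V) (z : Z) : ⟪z, D.bracket x y⟫_ℝ = ⟪D.J z x, y⟫_ℝ := by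
  rw [real_inner_comm, inner_bracket]

theorem bracket_J_self (z : Z) (v : V) : D.bracket (D.J z v) v = -(‖v‖ ^ 2) • z :=
  ext_inner_right ℝ fun w => by
    rw [inner_bracket, inner_J_left, inner_J_J_same, inner_smul_left]
    simp; ring

/-- Used for both summands: under `Swaps` only the mixed brackets of v₁ with v₂ survive. -/
theorem bracket_eq_zero {W W' : Submodule ℝ V} (h : W ⟂ W') (hJ : ∀ z : Z, ∀ v ∈ W, D.J z v ∈ W')
    {x x' : V} (hx : x ∈ W) (hx' : x' ∈ W) : D.bracket x x' = 0 :=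
  ext_inner_right ℝ fun z => by
    rw [inner_bracket, inner_zero_left]
    exact h.symm.inner_eq (hJ z x hx) hx'

/-- Expanding in an orthonormal basis z_j of Z and applying Parseval in V, each j contributes
⟨J_{z_j}x, J_{z_j}y⟩ = ⟨x, y⟩. This is one source of dim Z in the Laplacian. -/
theorem sum_inner_bracket {ι : Type*} [Fintype ι] (b : OrthonormalBasis ι ℝ V) (x y : V) :
    ∑ i, ⟪D.bracket x (b i), D.bracket y (b i)⟫_ℝ = Module.finrank ℝ Z * ⟪x, y⟫_ℝ := by
  have h : ∀ i, ⟪D.bracket x (b i), D.bracket y (b i)⟫_ℝ =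
      ∑ j, ⟪D.J (stdOrthonormalBasis ℝ Z j) x, b i⟫_ℝ *
        ⟪b i, D.J (stdOrthonormalBasis ℝ Z j) y⟫_ℝ := fun i => by
    rw [← (stdOrthonormalBasis ℝ Z).sum_inner_mul_inner]
    refine Finset.sum_congr rfl fun j _ => ?_
    rw [inner_bracket, inner_bracket_right, real_inner_comm (b i) (D.J _ y)]
  simp_rw [h]
  rw [Finset.sum_comm]
  simp [OrthonormalBasis.sum_inner_mul_inner, inner_J_J]

end Bracket

end DamekRicci

/-! ### Gradients in coordinates -/

namespace Riem

variable {E : Type*} [NormedAddCommGroup E] [NormedSpace ℝ E]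
variable {ι : Type*} [Fintype ι] [DecidableEq ι]

/-- The gradient is the vector field that represents the differential. -/
theorem gradient_eq (g : E → E → E → ℝ) (b : Module.Basis ι ℝ E) (F : E → ℝ) (p : E)
    (B : LinearMap.BilinForm ℝ E) (hB : ∀ X Y, B X Y = g p X Y) (hs : ∀ X Y, B X Y = B Y X)
    (hdet : (gram g b p).det ≠ 0) {G : E} (hG : ∀ X, g p G X = fderiv ℝ F p X) :
    gradient g b F p = G := by
  have h : (gram g b p).mulVec (b.repr G) = fun j => fderiv ℝ F p (b j) := by
    funext j
    rw [← hG (b j), ← hB, hs]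
    conv_rhs => rw [← b.sum_repr G, map_sum]
    refine Finset.sum_congr rfl fun i _ => ?_
    rw [map_smul, hB, smul_eq_mul, mul_comm]
    rfl
  have h' : (gram g b p)⁻¹.mulVec (fun j => fderiv ℝ F p (b j)) = b.repr G := by
    rw [← h, Matrix.mulVec_mulVec, Matrix.nonsing_inv_mul _ hdet.isUnit, Matrix.one_mulVec]
  rw [gradient]
  conv_rhs => rw [← b.sum_repr G]
  refine Finset.sum_congr rfl fun i _ => ?_
  rw [← congrFun h' i]
  rfl

end Riem

namespace DamekRicci

variable {V Z : Type*} [NormedAddCommGroup V] [InnerProductSpace ℝ V] [FiniteDimensional ℝ V]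
  [NormedAddCommGroup Z] [InnerProductSpace ℝ Z] [FiniteDimensional ℝ Z] (D : DamekRicci V Z)

/-! ### The coordinates and the metric -/

theorem coords_inl (i : Fin (Module.finrank ℝ V)) :
    coords V Z (Sum.inl i) = (stdOrthonormalBasis ℝ V i, 0, 0) := by
  simp [coords, Module.Basis.prod_apply, ← Prod.zero_eq_mk]

theorem coords_inr_inl (j : Fin (Module.finrank ℝ Z)) :
    coords V Z (Sum.inr (Sum.inl j)) = (0, stdOrthonormalBasis ℝ Z j, 0) := by
  simp [coords, Module.Basis.prod_apply]

theorem coords_inr_inr (u : Unit) : coords V Z (Sum.inr (Sum.inr u)) = (0, 0, 1) := by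
  simp [coords, Module.Basis.prod_apply]

theorem coords_repr_inl (X : V × Z × ℝ) (i : Fin (Module.finrank ℝ V)) :
    (coords V Z).repr X (Sum.inl i) = ⟪stdOrthonormalBasis ℝ V i, X.1⟫_ℝ := by
  simp [coords, OrthonormalBasis.repr_apply_apply]

theorem coords_repr_inr_inl (X : V × Z × ℝ) (j : Fin (Module.finrank ℝ Z)) :
    (coords V Z).repr X (Sum.inr (Sum.inl j)) = ⟪stdOrthonormalBasis ℝ Z j, X.2.1⟫_ℝ := by
  simp [coords, OrthonormalBasis.repr_apply_apply]

theorem coords_repr_inr_inr (X : V × Z × ℝ) (u : Unit) :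
    (coords V Z).repr X (Sum.inr (Sum.inr u)) = X.2.2 := by
  simp [coords]

/-- The metric at `p` as a bilinear form. -/
def metricForm (p : V × Z × ℝ) : LinearMap.BilinForm ℝ (V × Z × ℝ) :=
  LinearMap.mk₂ ℝ (D.metric p)
    (fun X X' Y => by
      simp only [metric, Prod.fst_add, Prod.snd_add, bracket_add_left, smul_add,
        inner_add_left]; ring)
    (fun c X Y => by
      simp only [metric, Prod.smul_fst, Prod.smul_snd, bracket_smul_left, smul_eq_mul,
        inner_add_left, real_inner_smul_left]; ring)
    (fun X Y Y' => by
      simp only [metric, Prod.fst_add, Prod.snd_add, bracket_add_left, smul_add,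
        inner_add_right]; ring)
    (fun c X Y => by
      simp only [metric, Prod.smul_fst, Prod.smul_snd, bracket_smul_left, smul_eq_mul,
        inner_add_right, real_inner_smul_right]; ring)

theorem metricForm_apply (p X Y : V × Z × ℝ) : D.metricForm p X Y = D.metric p X Y := rfl

theorem metric_comm (p X Y : V × Z × ℝ) : D.metric p X Y = D.metric p Y X := by
  simp only [metric, mul_comm Y.2.2]
  congr 3
  · exact real_inner_comm _ _
  · exact real_inner_comm _ _

theorem metric_self_nonneg {p : V × Z × ℝ} (hp : p ∈ halfSpace V Z) (X : V × Z × ℝ) :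
    0 ≤ D.metric p X X := by
  have hp' : 0 < p.2.2 := hp
  simp only [metric, real_inner_self_eq_norm_sq]
  have := mul_self_nonneg X.2.2
  positivity

theorem abs_metric_le {p : V × Z × ℝ} (hp : p ∈ halfSpace V Z) (X Y : V × Z × ℝ) :
    |D.metric p X Y| ≤ √(D.metric p X X) * √(D.metric p Y Y) := by
  rw [← Real.sqrt_mul (D.metric_self_nonneg hp X)]
  exact Real.abs_le_sqrt ((D.metricForm p).apply_sq_le_of_symm (D.metric_self_nonneg hp)
    ⟨fun X Y => D.metric_comm p X Y⟩ X Y)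

/-- The diagonal entries of the metric in an orthonormal frame rescaled by the height. -/
def frameWeight (V Z : Type*) [NormedAddCommGroup V] [InnerProductSpace ℝ V]
    [NormedAddCommGroup Z] [InnerProductSpace ℝ Z] (t : ℝ) :
    Fin (Module.finrank ℝ V) ⊕ Fin (Module.finrank ℝ Z) ⊕ Unit → ℝ :=
  Sum.elim (fun _ => 1 / t) (Sum.elim (fun _ => 1 / t ^ 2) (fun _ => 1 / t ^ 2))

/-- The matrix of the left invariant coframe at `p`, up to scaling by the height. -/
def coframe (p : V × Z × ℝ) :
    Matrix (Fin (Module.finrank ℝ V) ⊕ Fin (Module.finrank ℝ Z) ⊕ Unit)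
      (Fin (Module.finrank ℝ V) ⊕ Fin (Module.finrank ℝ Z) ⊕ Unit) ℝ :=
  Matrix.of fun k i => (coords V Z).repr
    ((coords V Z i).1, (coords V Z i).2.1 + (1 / 2 : ℝ) • D.bracket (coords V Z i).1 p.1,
      (coords V Z i).2.2) k

/-- The bracket only adds Z-components to the V-columns, so the matrix is block unipotent.
Consequently the volume density depends on the height alone. -/
theorem det_coframe (p : V × Z × ℝ) : (D.coframe p).det = 1 := by
  have h : D.coframe p = Matrix.fromBlocks 1 0
      (Matrix.of fun k i => D.coframe p (Sum.inr k) (Sum.inl i)) 1 := by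
    ext (k | k | k) (i | i | i) <;>
    simp [coframe, coords_inl, coords_inr_inl, coords_inr_inr, coords_repr_inl,
      coords_repr_inr_inl, coords_repr_inr_inr, bracket_zero_left, Matrix.one_apply,
      OrthonormalBasis.inner_eq_ite]
  rw [h, Matrix.det_fromBlocks_zero₁₂]
  simp

theorem gram_eq (p : V × Z × ℝ) :
    Riem.gram D.metric (coords V Z) p =
      (D.coframe p).transpose * Matrix.diagonal (frameWeight V Z p.2.2) * D.coframe p := by
  ext i j
  rw [Matrix.mul_apply]
  simp only [Riem.gram, Matrix.of_apply, Matrix.mul_diagonal,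
    Matrix.transpose_apply, Fintype.sum_sum_type, frameWeight, Sum.elim_inl, Sum.elim_inr,
    coframe, coords_repr_inl, coords_repr_inr_inl, coords_repr_inr_inr, metric,
    Finset.univ_unique, Finset.sum_singleton]
  rw [← (stdOrthonormalBasis ℝ V).sum_inner_mul_inner, ← (stdOrthonormalBasis ℝ Z).sum_inner_mul_inner,
    Finset.mul_sum, Finset.mul_sum, add_assoc]
  congr 1
  · refine Finset.sum_congr rfl fun k _ => ?_
    rw [real_inner_comm (stdOrthonormalBasis ℝ V k)]; ring
  congr 1
  · refine Finset.sum_congr rfl fun k _ => ?_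
    rw [real_inner_comm (stdOrthonormalBasis ℝ Z k)]; ring
  · ring

theorem det_gram (p : V × Z × ℝ) :
    (Riem.gram D.metric (coords V Z) p).det =
      (1 / p.2.2) ^ Module.finrank ℝ V * ((1 / p.2.2 ^ 2) ^ Module.finrank ℝ Z *
        (1 / p.2.2 ^ 2)) := by
  rw [gram_eq, Matrix.det_mul, Matrix.det_mul, Matrix.det_transpose, det_coframe,
    Matrix.det_diagonal, one_mul, mul_one]
  simp only [frameWeight, Fintype.prod_sum_type, Sum.elim_inl, Sum.elim_inr, Finset.prod_const,
    Finset.card_univ, Fintype.card_fin, Fintype.card_unit, pow_one]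

theorem gradient_eq {F : V × Z × ℝ → ℝ} {p : V × Z × ℝ} (hp : p ∈ halfSpace V Z)
    {G : V × Z × ℝ} (hG : ∀ X, D.metric p G X = fderiv ℝ F p X) :
    Riem.gradient D.metric (coords V Z) F p = G := by
  have hp' : 0 < p.2.2 := hp
  refine Riem.gradient_eq _ _ _ _ (D.metricForm p) (fun _ _ => rfl) (D.metric_comm p) ?_ hG
  rw [det_gram]
  positivity

theorem volDensity_eq (p : V × Z × ℝ) :
    Riem.volDensity D.metric (coords V Z) p =
      √((1 / p.2.2) ^ (Module.finrank ℝ V + 2 * Module.finrank ℝ Z + 2)) := by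
  rw [Riem.volDensity, det_gram]
  congr 1
  ring

/-- The logarithmic derivative of the volume density. -/
theorem hasFDerivAt_volDensity {p : V × Z × ℝ} (hp : p ∈ halfSpace V Z) :
    ∃ L : V × Z × ℝ →L[ℝ] ℝ, HasFDerivAt (Riem.volDensity D.metric (coords V Z)) L p ∧
      ∀ X, L X = -((Module.finrank ℝ V + 2 * Module.finrank ℝ Z + 2 : ℕ) / 2 : ℝ) / p.2.2 *
        Riem.volDensity D.metric (coords V Z) p * X.2.2 := by
  have hp' : 0 < p.2.2 := hp
  set N := Module.finrank ℝ V + 2 * Module.finrank ℝ Z + 2 with hN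
  have hpos : 0 < (1 / p.2.2) ^ N := by positivity
  have h₁ : HasDerivAt (fun t : ℝ => √((1 / t) ^ N))
      (-(N / 2 : ℝ) / p.2.2 * √((1 / p.2.2) ^ N)) p.2.2 := by
    have h := (((hasDerivAt_inv hp'.ne').pow N).sqrt (by simpa using hpos.ne'))
    simp only [Pi.pow_apply, ← one_div] at h
    convert h using 1
    have hs : √((1 / p.2.2) ^ N) ≠ 0 := (Real.sqrt_pos.2 hpos).ne'
    have hss : √((1 / p.2.2) ^ N) * √((1 / p.2.2) ^ N) = (1 / p.2.2) ^ N :=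
      Real.mul_self_sqrt hpos.le
    -- N has the summand 2, so the truncated subtraction N - 1 is a genuine one.
    have hN1 : (1 / p.2.2) ^ N = (1 / p.2.2) ^ (N - 1) * (1 / p.2.2) := by
      rw [← pow_succ, Nat.sub_add_cancel (by omega)]
    rw [eq_div_iff (by positivity)]
    have hss' : √((1 / p.2.2) ^ N) * √((1 / p.2.2) ^ N) = (1 / p.2.2) ^ (N - 1) * (1 / p.2.2) :=
      hss.trans hN1
    generalize √((1 / p.2.2) ^ N) = s at *
    have : p.2.2 ≠ 0 := hp'.ne'
    calc -(N / 2 : ℝ) / p.2.2 * s * (2 * s) = -N / p.2.2 * (s * s) := by ring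
      _ = _ := by rw [hss']; field_simp
  have h₂ : HasFDerivAt (fun q : V × Z × ℝ => q.2.2)
      ((ContinuousLinearMap.snd ℝ Z ℝ).comp (ContinuousLinearMap.snd ℝ V (Z × ℝ))) p :=
    ((ContinuousLinearMap.snd ℝ Z ℝ).comp (ContinuousLinearMap.snd ℝ V (Z × ℝ))).hasFDerivAt
  have h₃ := h₁.comp_hasFDerivAt p h₂
  refine ⟨_, h₃.congr_of_eventuallyEq (.of_forall D.volDensity_eq), fun X => ?_⟩
  rw [volDensity_eq]
  rfl

end DamekRicci

namespace DamekRicci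

variable {V Z : Type*} [NormedAddCommGroup V] [InnerProductSpace ℝ V] [FiniteDimensional ℝ V]
  [NormedAddCommGroup Z] [InnerProductSpace ℝ Z] [FiniteDimensional ℝ Z] (D : DamekRicci V Z)
  (v₁ v₂ : Submodule ℝ V)

theorem isOpen_halfSpace : IsOpen (halfSpace V Z) :=
  isOpen_lt continuous_const (continuous_snd.comp continuous_snd)

/-! ### The differential of `F` -/

/-- The term `t + ½‖Π₂ v‖²` of `F`. -/
def quarticA (p : V × Z × ℝ) : ℝ := p.2.2 + 1 / 2 * ‖v₂.starProjection p.1‖ ^ 2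

/-- The term `z - ½[Π₁ v, Π₂ v]` of `F`. -/
def quarticB (p : V × Z × ℝ) : Z :=
  p.2.1 - (1 / 2 : ℝ) • D.bracket (v₁.starProjection p.1) (v₂.starProjection p.1)

theorem quarticF_eq (p : V × Z × ℝ) :
    D.quarticF v₁ v₂ p = (quarticA v₂ p ^ 2 + ‖D.quarticB v₁ v₂ p‖ ^ 2) / p.2.2 ^ 2 := rfl

theorem contDiff_quarticA {n : WithTop ℕ∞} :
    ContDiff ℝ n (quarticA v₂ : V × Z × ℝ → ℝ) := by
  unfold quarticA
  have : ContDiff ℝ n fun p : V × Z × ℝ => v₂.starProjection p.1 := by fun_prop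
  exact contDiff_snd.snd.add (contDiff_const.mul (this.norm_sq ℝ))

theorem contDiff_quarticB {n : WithTop ℕ∞} : ContDiff ℝ n (D.quarticB v₁ v₂) := by
  unfold quarticB
  simp only [← bracketL_apply]
  fun_prop

theorem contDiffOn_quarticF {n : WithTop ℕ∞} :
    ContDiffOn ℝ n (D.quarticF v₁ v₂) (halfSpace V Z) := by
  have h : ContDiff ℝ n fun p : V × Z × ℝ => quarticA v₂ p ^ 2 + ‖D.quarticB v₁ v₂ p‖ ^ 2 :=
    ((contDiff_quarticA v₂).pow 2).add ((D.contDiff_quarticB v₁ v₂).norm_sq ℝ)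
  refine h.contDiffOn.div (contDiff_snd.snd.pow 2).contDiffOn fun p hp => ?_
  have hp' : 0 < p.2.2 := hp
  positivity

theorem hasFDerivAt_height (p : V × Z × ℝ) :
    HasFDerivAt (fun q : V × Z × ℝ => q.2.2)
      ((ContinuousLinearMap.snd ℝ Z ℝ).comp (ContinuousLinearMap.snd ℝ V (Z × ℝ))) p :=
  ((ContinuousLinearMap.snd ℝ Z ℝ).comp (ContinuousLinearMap.snd ℝ V (Z × ℝ))).hasFDerivAt

theorem hasFDerivAt_starProjection (W : Submodule ℝ V) (p : V × Z × ℝ) :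
    HasFDerivAt (fun q : V × Z × ℝ => W.starProjection q.1)
      (W.starProjection.comp (ContinuousLinearMap.fst ℝ V (Z × ℝ))) p :=
  (W.starProjection.comp (ContinuousLinearMap.fst ℝ V (Z × ℝ))).hasFDerivAt

theorem hasFDerivAt_quarticA (p : V × Z × ℝ) :
    ∃ L : V × Z × ℝ →L[ℝ] ℝ, HasFDerivAt (quarticA v₂ : V × Z × ℝ → ℝ) L p ∧
      ∀ X, L X = X.2.2 + ⟪v₂.starProjection p.1, v₂.starProjection X.1⟫_ℝ := by
  refine ⟨_, (hasFDerivAt_height p).add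
    ((hasFDerivAt_starProjection v₂ p).norm_sq.const_mul (1 / 2 : ℝ)), fun X => ?_⟩
  simp

theorem hasFDerivAt_quarticB (p : V × Z × ℝ) :
    ∃ L : V × Z × ℝ →L[ℝ] Z, HasFDerivAt (D.quarticB v₁ v₂) L p ∧
      ∀ X, L X = X.2.1 - (1 / 2 : ℝ) •
        (D.bracket (v₁.starProjection X.1) (v₂.starProjection p.1) +
          D.bracket (v₁.starProjection p.1) (v₂.starProjection X.1)) := by
  have h₁ : HasFDerivAt (fun q : V × Z × ℝ => q.2.1)
      ((ContinuousLinearMap.fst ℝ Z ℝ).comp (ContinuousLinearMap.snd ℝ V (Z × ℝ))) p :=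
    ((ContinuousLinearMap.fst ℝ Z ℝ).comp (ContinuousLinearMap.snd ℝ V (Z × ℝ))).hasFDerivAt
  refine ⟨_, h₁.sub ((D.bracketL.hasFDerivAt_of_bilinear (hasFDerivAt_starProjection v₁ p)
    (hasFDerivAt_starProjection v₂ p)).const_smul (1 / 2 : ℝ)), fun X => ?_⟩
  simp [bracketL_apply, add_comm]

theorem fderiv_quarticF {p : V × Z × ℝ} (hp : p ∈ halfSpace V Z) (X : V × Z × ℝ) :
    fderiv ℝ (D.quarticF v₁ v₂) p X =
      (2 * quarticA v₂ p * (X.2.2 + ⟪v₂.starProjection p.1, v₂.starProjection X.1⟫_ℝ) +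
        2 * ⟪D.quarticB v₁ v₂ p, X.2.1 - (1 / 2 : ℝ) •
        (D.bracket (v₁.starProjection X.1) (v₂.starProjection p.1) +
          D.bracket (v₁.starProjection p.1) (v₂.starProjection X.1))⟫_ℝ) / p.2.2 ^ 2 -
        2 * D.quarticF v₁ v₂ p / p.2.2 * X.2.2 := by
  have hp' : p.2.2 ≠ 0 := (show 0 < p.2.2 from hp).ne'
  obtain ⟨LA, hA, hA'⟩ := hasFDerivAt_quarticA (Z := Z) v₂ p
  obtain ⟨LB, hB, hB'⟩ := D.hasFDerivAt_quarticB v₁ v₂ p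
  have h := ((hA.pow 2).add hB.norm_sq).mul (((hasDerivAt_inv (pow_ne_zero 2 hp')).comp_hasFDerivAt p
    ((hasFDerivAt_height p).pow 2)))
  have hF : HasFDerivAt (D.quarticF v₁ v₂) _ p := h
  rw [hF.fderiv, ← hA' X, ← hB' X, quarticF_eq]
  simp
  field_simp
  ring

/-- The component in `V` of the gradient of `F`. -/
def gradFst (p : V × Z × ℝ) : V :=
  p.2.2⁻¹ • ((2 * quarticA v₂ p) • v₂.starProjection p.1 +
    v₂.starProjection (D.J (D.quarticB v₁ v₂ p) (v₂.starProjection p.1)) +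
    v₁.starProjection (D.J (D.quarticB v₁ v₂ p)
      (v₁.starProjection p.1 + (2 : ℝ) • v₂.starProjection p.1)))

/-- The gradient of `F`, see `metric_gradF`. -/
def gradF (p : V × Z × ℝ) : V × Z × ℝ :=
  (D.gradFst v₁ v₂ p, (2 : ℝ) • D.quarticB v₁ v₂ p - (1 / 2 : ℝ) • D.bracket (D.gradFst v₁ v₂ p) p.1,
    2 * quarticA v₂ p - 2 * D.quarticF v₁ v₂ p * p.2.2)

variable {v₁ v₂}

theorem inner_starProjection_comm (W : Submodule ℝ V) (x y : V) :
    ⟪W.starProjection x, y⟫_ℝ = ⟪x, W.starProjection y⟫_ℝ :=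
  Submodule.inner_starProjection_left_eq_right W x y

/-- The term -½[G, v] in the Z-component of `gradF`, G being its V-component, cancels the shift
built into the metric and leaves 2B. Self-adjointness of the projections and skewness of J_B then
match the V-components. -/
theorem metric_gradF (horth : v₁ ⟂ v₂) (hsum : v₁ ⊔ v₂ = ⊤) {p : V × Z × ℝ}
    (hp : p ∈ halfSpace V Z) (X : V × Z × ℝ) :
    D.metric p (D.gradF v₁ v₂ p) X = fderiv ℝ (D.quarticF v₁ v₂) p X := by
  have hp' : p.2.2 ≠ 0 := (show 0 < p.2.2 from hp).ne'
  rw [fderiv_quarticF _ _ _ hp]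
  simp only [metric, gradF, sub_add_cancel, gradFst, real_inner_smul_left, inner_add_left,
    inner_starProjection_comm]
  have hX := horth.starProjection_add_starProjection hsum X.1
  have hv := horth.starProjection_add_starProjection hsum p.1
  have hidem : v₂.starProjection (v₂.starProjection X.1) = v₂.starProjection X.1 :=
    v₂.starProjection_eq_self_iff.2 (v₂.starProjection_apply_mem _)
  have hbr : ⟪D.quarticB v₁ v₂ p, D.bracket X.1 p.1⟫_ℝ =
      ⟪D.J (D.quarticB v₁ v₂ p) (v₁.starProjection X.1 + v₂.starProjection X.1),
        v₁.starProjection p.1 + v₂.starProjection p.1⟫_ℝ := by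
    rw [inner_bracket_right, hX, hv]
  have e1 : ⟪p.1, v₂.starProjection X.1⟫_ℝ = ⟪v₂.starProjection p.1, v₂.starProjection X.1⟫_ℝ := by
    rw [inner_starProjection_comm, hidem]
  have hc : ∀ a b : V, ⟪D.J (D.quarticB v₁ v₂ p) a, b⟫_ℝ = -⟪D.J (D.quarticB v₁ v₂ p) b, a⟫_ℝ :=
    fun a b => by rw [inner_J_left, real_inner_comm]
  simp only [inner_add_right, inner_sub_right, real_inner_smul_right, hbr, hidem, e1,
    inner_bracket_right, map_add, map_smul, inner_add_left, real_inner_smul_left]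
  rw [hc (v₁.starProjection p.1) (v₂.starProjection X.1),
    hc (v₂.starProjection p.1) (v₂.starProjection X.1),
    hc (v₁.starProjection p.1) (v₁.starProjection X.1),
    hc (v₂.starProjection p.1) (v₁.starProjection X.1)]
  field_simp
  ring

theorem gradient_quarticF (horth : v₁ ⟂ v₂) (hsum : v₁ ⊔ v₂ = ⊤) {p : V × Z × ℝ}
    (hp : p ∈ halfSpace V Z) :
    Riem.gradient D.metric (coords V Z) (D.quarticF v₁ v₂) p = D.gradF v₁ v₂ p :=
  D.gradient_eq hp (D.metric_gradF horth hsum hp)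

/-- The three summands of `gradFst` are mutually orthogonal: y ⟂ Π₂J_B y by skewness, and the third
lies in v₁. Substituting ‖y‖² = 2(A - t) isolates 4F(F - 1); the rest measures how far J_B is from
interchanging v₁ and v₂. -/
theorem metric_gradF_self (horth : v₁ ⟂ v₂) {p : V × Z × ℝ}
    (hp : p ∈ halfSpace V Z) :
    D.metric p (D.gradF v₁ v₂ p) (D.gradF v₁ v₂ p) =
      4 * D.quarticF v₁ v₂ p * (D.quarticF v₁ v₂ p - 1) + 1 / p.2.2 ^ 3 *
      (‖v₂.starProjection (D.J (D.quarticB v₁ v₂ p) (v₂.starProjection p.1))‖ ^ 2 +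
       ‖v₁.starProjection (D.J (D.quarticB v₁ v₂ p)
        (v₁.starProjection p.1 + (2 : ℝ) • v₂.starProjection p.1))‖ ^ 2 -
       4 * ‖D.quarticB v₁ v₂ p‖ ^ 2 * ‖v₂.starProjection p.1‖ ^ 2) := by
  have hp' : p.2.2 ≠ 0 := (show 0 < p.2.2 from hp).ne'
  set a := v₂.starProjection (D.J (D.quarticB v₁ v₂ p) (v₂.starProjection p.1)) with ha
  set b := v₁.starProjection (D.J (D.quarticB v₁ v₂ p)
        (v₁.starProjection p.1 + (2 : ℝ) • v₂.starProjection p.1)) with hb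
  have h2 := v₂.starProjection_apply_mem p.1
  have h₁ : ⟪v₂.starProjection p.1, a⟫_ℝ = 0 := by
    rw [ha, ← inner_starProjection_comm, v₂.starProjection_eq_self_iff.2 h2,
      real_inner_comm, inner_J_self]
  have h₂ : ⟪v₂.starProjection p.1, b⟫_ℝ = 0 :=
    horth.symm.inner_eq h2 (v₁.starProjection_apply_mem _)
  have h₃ : ⟪a, b⟫_ℝ = 0 :=
    horth.symm.inner_eq (v₂.starProjection_apply_mem _) (v₁.starProjection_apply_mem _)
  have hn : ⟪D.gradFst v₁ v₂ p, D.gradFst v₁ v₂ p⟫_ℝ = (p.2.2⁻¹) ^ 2 *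
      (4 * quarticA v₂ p ^ 2 * ‖v₂.starProjection p.1‖ ^ 2 + ‖a‖ ^ 2 + ‖b‖ ^ 2) := by
    have h₁' : ⟪a, v₂.starProjection p.1⟫_ℝ = 0 := by rw [real_inner_comm, h₁]
    have h₂' : ⟪b, v₂.starProjection p.1⟫_ℝ = 0 := by rw [real_inner_comm, h₂]
    have h₃' : ⟪b, a⟫_ℝ = 0 := by rw [real_inner_comm, h₃]
    simp only [gradFst, ← ha, ← hb, real_inner_smul_left, real_inner_smul_right, inner_add_left,
      inner_add_right, h₁, h₂, h₃, h₁', h₂', h₃', ← real_inner_self_eq_norm_sq]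
    ring
  simp only [metric, gradF, sub_add_cancel, hn, real_inner_smul_left, real_inner_smul_right]
  rw [real_inner_self_eq_norm_sq]
  have hy : ‖v₂.starProjection p.1‖ ^ 2 = 2 * (quarticA v₂ p - p.2.2) := by
    rw [quarticA]; ring
  rw [hy, quarticF_eq]
  field_simp
  ring

end DamekRicci

namespace DamekRicci

variable {V Z : Type*} [NormedAddCommGroup V] [InnerProductSpace ℝ V] [FiniteDimensional ℝ V]
  [NormedAddCommGroup Z] [InnerProductSpace ℝ Z] [FiniteDimensional ℝ Z] {D : DamekRicci V Z}
  {v₁ v₂ : Submodule ℝ V}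

/-! ### Transnormality -/

theorem gradFst_of_swaps (hJ : D.Swaps v₁ v₂) (horth : v₁ ⟂ v₂) (p : V × Z × ℝ) :
    D.gradFst v₁ v₂ p = p.2.2⁻¹ • ((2 * quarticA v₂ p) • v₂.starProjection p.1 +
      (2 : ℝ) • D.J (D.quarticB v₁ v₂ p) (v₂.starProjection p.1)) := by
  rw [gradFst, map_add, map_add, map_smul, map_smul,
    horth.symm.starProjection_eq_zero (hJ.2 _ _ (v₂.starProjection_apply_mem p.1)),
    horth.starProjection_eq_zero (hJ.1 _ _ (v₁.starProjection_apply_mem p.1)),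
    v₁.starProjection_eq_self_iff.2 (hJ.2 _ _ (v₂.starProjection_apply_mem p.1)), add_zero, zero_add]

theorem metric_gradF_self_of_swaps (hJ : D.Swaps v₁ v₂) (horth : v₁ ⟂ v₂)
    {p : V × Z × ℝ} (hp : p ∈ halfSpace V Z) :
    D.metric p (D.gradF v₁ v₂ p) (D.gradF v₁ v₂ p) =
      4 * D.quarticF v₁ v₂ p * (D.quarticF v₁ v₂ p - 1) := by
  rw [metric_gradF_self D horth hp, map_add, map_add, map_smul, map_smul,
    horth.symm.starProjection_eq_zero (hJ.2 _ _ (v₂.starProjection_apply_mem p.1)),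
    horth.starProjection_eq_zero (hJ.1 _ _ (v₁.starProjection_apply_mem p.1)),
    v₁.starProjection_eq_self_iff.2 (hJ.2 _ _ (v₂.starProjection_apply_mem p.1)), zero_add,
    norm_smul, norm_J, norm_zero]
  norm_num
  right
  ring

theorem quarticB_of_mem_left (horth : v₁ ⟂ v₂) {x : V} (hx : x ∈ v₁) (z : Z) (t : ℝ) :
    D.quarticB v₁ v₂ (x, z, t) = z := by
  simp [quarticB, horth.symm.starProjection_eq_zero hx, bracket_zero_right]

theorem quarticB_of_mem_right (horth : v₁ ⟂ v₂) {y : V} (hy : y ∈ v₂) (z : Z) (t : ℝ) :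
    D.quarticB v₁ v₂ (y, z, t) = z := by
  simp [quarticB, horth.starProjection_eq_zero hy, bracket_zero_left]

theorem quarticF_of_mem_left (horth : v₁ ⟂ v₂) {x : V} (hx : x ∈ v₁) (z : Z) :
    D.quarticF v₁ v₂ (x, z, 1) = 1 + ‖z‖ ^ 2 := by
  rw [quarticF_eq, quarticB_of_mem_left horth hx]
  simp [quarticA, horth.symm.starProjection_eq_zero hx]

theorem mem_halfSpace_one (x : V) (z : Z) : (x, z, (1 : ℝ)) ∈ halfSpace V Z :=
  show (0 : ℝ) < 1 from one_pos

theorem one_le_quarticF {p : V × Z × ℝ} (hp : p ∈ halfSpace V Z) :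
    1 ≤ D.quarticF v₁ v₂ p := by
  have hp' : 0 < p.2.2 := hp
  rw [quarticF_eq, le_div_iff₀ (by positivity), one_mul]
  have : p.2.2 ≤ quarticA v₂ p := le_add_of_nonneg_right (by positivity)
  nlinarith [sq_nonneg ‖D.quarticB v₁ v₂ p‖]

theorem gradNormSq_quarticF (horth : v₁ ⟂ v₂) (hsum : v₁ ⊔ v₂ = ⊤)
    {p : V × Z × ℝ} (hp : p ∈ halfSpace V Z) :
    Riem.gradNormSq D.metric (coords V Z) (D.quarticF v₁ v₂) p =
      D.metric p (D.gradF v₁ v₂ p) (D.gradF v₁ v₂ p) := by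
  rw [Riem.gradNormSq, gradient_quarticF D horth hsum hp]

/-- Every value `c ≥ 1` is attained by `F` at the height `1` on the axis `v = 0`. -/
theorem exists_quarticF_eq (horth : v₁ ⟂ v₂) {z : Z} (hz : z ≠ 0) {c : ℝ} (hc : 1 ≤ c) :
    ∃ w : Z, D.quarticF v₁ v₂ (0, w, 1) = c := by
  refine ⟨(√(c - 1) / ‖z‖) • z, ?_⟩
  have hz' : ‖z‖ ≠ 0 := by simpa using hz
  rw [quarticF_of_mem_left horth v₁.zero_mem, norm_smul, Real.norm_of_nonneg (by positivity),
    div_mul_cancel₀ _ hz', Real.sq_sqrt (by linarith)]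
  ring

theorem isTransnormal_of_swaps (hJ : D.Swaps v₁ v₂) (horth : v₁ ⟂ v₂) (hsum : v₁ ⊔ v₂ = ⊤) :
    D.IsTransnormal (D.quarticF v₁ v₂) := by
  refine ⟨D.contDiffOn_quarticF v₁ v₂, fun c => 4 * c * (c - 1), ?_, fun p hp => ?_⟩
  · fun_prop
  · rw [gradNormSq_quarticF horth hsum hp, metric_gradF_self_of_swaps hJ horth hp]

theorem swaps_of_isTransnormal (horth : v₁ ⟂ v₂) (hsum : v₁ ⊔ v₂ = ⊤)
    (h : D.IsTransnormal (D.quarticF v₁ v₂)) : D.Swaps v₁ v₂ := by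
  obtain ⟨-, β, -, hβ⟩ := h
  have hg : ∀ p ∈ halfSpace V Z, D.metric p (D.gradF v₁ v₂ p) (D.gradF v₁ v₂ p) =
      β (D.quarticF v₁ v₂ p) := fun p hp => by rw [← hβ p hp, gradNormSq_quarticF horth hsum hp]
  have hleft : ∀ z : Z, ∀ x ∈ v₁, 4 * (1 + ‖z‖ ^ 2) * ‖z‖ ^ 2 + ‖v₁.starProjection (D.J z x)‖ ^ 2 =
      β (1 + ‖z‖ ^ 2) := fun z x hx => by
    have h := hg _ (mem_halfSpace_one x z)
    rw [metric_gradF_self D horth (mem_halfSpace_one x z), quarticF_of_mem_left horth hx,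
      quarticB_of_mem_left horth hx] at h
    rw [← h]
    simp [horth.symm.starProjection_eq_zero hx, v₁.starProjection_eq_self_iff.2 hx]
  -- The point x = 0 determines β; every other x ∈ v₁ must then have no defect.
  have hβ' : ∀ z : Z, β (1 + ‖z‖ ^ 2) = 4 * (1 + ‖z‖ ^ 2) * ‖z‖ ^ 2 := fun z => by
    rw [← hleft z 0 v₁.zero_mem]; simp
  constructor
  · intro z x hx
    have h := hleft z x hx
    rw [hβ', add_eq_left, sq_eq_zero_iff, norm_eq_zero,
      Submodule.starProjection_apply_eq_zero_iff] at h
    rwa [← horth.orthogonal_eq_of_sup_eq_top hsum]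
  · intro z y hy
    rcases eq_or_ne z 0 with rfl | hz
    · simp
    have h := hg _ (mem_halfSpace_one y z)
    -- A point on the axis v = 0 with the same value of F supplies β at that value.
    obtain ⟨w, hw⟩ := exists_quarticF_eq (D := D) horth hz
      (one_le_quarticF (D := D) (v₁ := v₁) (v₂ := v₂) (mem_halfSpace_one y z))
    have hw' := hβ' w
    rw [quarticF_of_mem_left horth v₁.zero_mem] at hw
    rw [hw] at hw'
    rw [hw', metric_gradF_self D horth (mem_halfSpace_one y z),
      quarticB_of_mem_right horth hy, horth.starProjection_eq_zero hy,
      v₂.starProjection_eq_self_iff.2 hy, zero_add, map_smul, map_smul, norm_smul] at h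
    have hpyth : ‖v₁.starProjection (D.J z y)‖ ^ 2 + ‖v₂.starProjection (D.J z y)‖ ^ 2 =
        ‖z‖ ^ 2 * ‖y‖ ^ 2 := by
      have h₁ := norm_add_sq_eq_norm_sq_add_norm_sq_real (horth.inner_eq
        (v₁.starProjection_apply_mem (D.J z y)) (v₂.starProjection_apply_mem (D.J z y)))
      rw [horth.starProjection_add_starProjection hsum, norm_J] at h₁
      nlinarith
    -- Vanishing of the defect reads ‖Π₂J_z y‖² + 4‖Π₁J_z y‖² = 4‖z‖²‖y‖². Subtracting four times
    -- Pythagoras leaves -3‖Π₂J_z y‖² = 0.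
    have hQ : ‖v₂.starProjection (D.J z y)‖ ^ 2 = 0 := by
      rw [← hw] at h
      norm_num at h
      nlinarith
    rw [sq_eq_zero_iff, norm_eq_zero] at hQ
    have hd := horth.starProjection_add_starProjection hsum (D.J z y)
    rw [hQ, add_zero] at hd
    exact v₁.starProjection_eq_self_iff.1 hd

/-! ### The Laplacian -/

/-- The divergence of G is the trace of its derivative plus the logarithmic derivative of the volume
density along G. The density is t^(-(n + 2m + 2)/2), so only the height component of G enters the
second part. -/
theorem laplacian_eq (D : DamekRicci V Z) {F : V × Z × ℝ → ℝ} {G : V × Z × ℝ → V × Z × ℝ}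
    {p : V × Z × ℝ} (hp : p ∈ halfSpace V Z)
    (hG : ∀ q ∈ halfSpace V Z, Riem.gradient D.metric (coords V Z) F q = G q)
    {G' : V × Z × ℝ →L[ℝ] V × Z × ℝ} (hG' : HasFDerivAt G G' p) :
    Riem.laplacian D.metric (coords V Z) F p =
      ∑ i, ⟪stdOrthonormalBasis ℝ V i, (G' (stdOrthonormalBasis ℝ V i, 0, 0)).1⟫_ℝ +
      ∑ j, ⟪stdOrthonormalBasis ℝ Z j, (G' (0, stdOrthonormalBasis ℝ Z j, 0)).2.1⟫_ℝ +
      (G' (0, 0, 1)).2.2 -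
      (Module.finrank ℝ V + 2 * Module.finrank ℝ Z + 2) / 2 / p.2.2 * (G p).2.2 := by
  have hp' : 0 < p.2.2 := hp
  obtain ⟨L, hL, hL'⟩ := D.hasFDerivAt_volDensity hp
  have hvol : Riem.volDensity D.metric (coords V Z) p ≠ 0 := by
    rw [volDensity_eq]; positivity
  set vol := Riem.volDensity D.metric (coords V Z) p with hvol_def
  have h : ∀ i, fderiv ℝ (fun q => Riem.volDensity D.metric (coords V Z) q *
      (coords V Z).repr (Riem.gradient D.metric (coords V Z) F q) i) p (coords V Z i) =
      vol * (coords V Z).repr (G' (coords V Z i)) i +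
        (coords V Z).repr (G p) i * L (coords V Z i) := fun i => by
    have hr : HasFDerivAt (fun q => (coords V Z).repr (G q) i)
        ((LinearMap.toContinuousLinearMap ((coords V Z).coord i)).comp G') p :=
      (LinearMap.toContinuousLinearMap ((coords V Z).coord i)).hasFDerivAt.comp p hG'
    have he : (fun q => Riem.volDensity D.metric (coords V Z) q *
        (coords V Z).repr (Riem.gradient D.metric (coords V Z) F q) i) =ᶠ[nhds p]
        fun q => Riem.volDensity D.metric (coords V Z) q * (coords V Z).repr (G q) i := by
      filter_upwards [isOpen_halfSpace.mem_nhds hp] with q hq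
      rw [hG q hq]
    have hm : HasFDerivAt (fun q => Riem.volDensity D.metric (coords V Z) q *
        (coords V Z).repr (G q) i) _ p := hL.mul hr
    rw [he.fderiv_eq, hm.fderiv]
    rfl
  rw [Riem.laplacian, ← hvol_def]
  simp_rw [h, hL']
  simp only [Fintype.sum_sum_type, coords_inl, coords_inr_inl, coords_inr_inr, coords_repr_inl,
    coords_repr_inr_inl, coords_repr_inr_inr, mul_zero, add_zero, Finset.univ_unique,
    Finset.sum_singleton, ← Finset.mul_sum]
  push_cast
  field_simp
  ring

/-- These are the only derivatives of `gradFst` that the trace needs: along V for the V-block, and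
along Z through the bracket term in the Z-component of `gradF`. -/
theorem hasFDerivAt_gradFst (hJ : D.Swaps v₁ v₂) (horth : v₁ ⟂ v₂) {p : V × Z × ℝ}
    (hp : p ∈ halfSpace V Z) :
    ∃ L : V × Z × ℝ →L[ℝ] V, HasFDerivAt (D.gradFst v₁ v₂) L p ∧
      (∀ u, L (u, 0, 0) = p.2.2⁻¹ • (
        (2 * ⟪v₂.starProjection p.1, v₂.starProjection u⟫_ℝ) • v₂.starProjection p.1 +
        (2 * quarticA v₂ p) • v₂.starProjection u +
        (2 : ℝ) • D.J (D.quarticB v₁ v₂ p) (v₂.starProjection u) -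
        D.J (D.bracket (v₁.starProjection u) (v₂.starProjection p.1) +
          D.bracket (v₁.starProjection p.1) (v₂.starProjection u)) (v₂.starProjection p.1))) ∧
      (∀ w, L (0, w, 0) = (2 * p.2.2⁻¹) • D.J w (v₂.starProjection p.1)) := by
  have hp' : p.2.2 ≠ 0 := (show 0 < p.2.2 from hp).ne'
  obtain ⟨LA, hA, hA'⟩ := hasFDerivAt_quarticA (Z := Z) v₂ p
  obtain ⟨LB, hB, hB'⟩ := D.hasFDerivAt_quarticB v₁ v₂ p
  have hy := hasFDerivAt_starProjection (Z := Z) v₂ p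
  have h := ((hasDerivAt_inv hp').comp_hasFDerivAt p (hasFDerivAt_height p)).smul
    (((hA.const_mul 2).smul hy).add ((D.JL.hasFDerivAt_of_bilinear hB hy).const_smul (2 : ℝ)))
  have hF : HasFDerivAt (D.gradFst v₁ v₂) _ p :=
    h.congr_of_eventuallyEq (.of_forall fun q => gradFst_of_swaps hJ horth q)
  refine ⟨_, hF, fun u => ?_, fun w => ?_⟩
  · simp [hA', hB', JL_apply]
    module
  · simp [hA', hB', JL_apply, bracket_zero_left, bracket_zero_right, smul_smul]
    module

/-- By cyclicity tr(J_zΠ₂) = tr(Π₂J_zΠ₂), and Π₂J_zΠ₂ = 0 because J_z maps v₂ into v₁. -/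
theorem sum_inner_J_starProjection {ι : Type*} [Fintype ι] (b : OrthonormalBasis ι ℝ V)
    (hJ : D.Swaps v₁ v₂) (horth : v₁ ⟂ v₂) (z : Z) :
    ∑ i, ⟪b i, D.J z (v₂.starProjection (b i))⟫_ℝ = 0 := by
  have h : (v₂.starProjection : V →ₗ[ℝ] V) * D.J z * (v₂.starProjection : V →ₗ[ℝ] V) = 0 :=
    LinearMap.ext fun x =>
      horth.symm.starProjection_eq_zero (hJ.2 z _ (v₂.starProjection_apply_mem x))
  have hQ : (v₂.starProjection : V →ₗ[ℝ] V) * (v₂.starProjection : V →ₗ[ℝ] V) =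
      v₂.starProjection := LinearMap.ext fun x =>
    v₂.starProjection_eq_self_iff.2 (v₂.starProjection_apply_mem x)
  have ht := LinearMap.trace_eq_sum_inner (D.J z * (v₂.starProjection : V →ₗ[ℝ] V)) b
  rw [← hQ, ← mul_assoc, LinearMap.trace_mul_comm, ← mul_assoc, h, map_zero] at ht
  rw [ht]
  refine Finset.sum_congr rfl fun i _ => ?_
  rw [mul_assoc, hQ]
  rfl

/-- This is the V-block of the trace. Up to the factor 1/t, the rank-one term gives 2‖y‖², the
projection 2A dim v₂, the J_B-term 0 and the bracket term m(‖y‖² - ⟨x, y⟩) = m‖y‖². -/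
theorem sum_inner_gradFst {ι : Type*} [Fintype ι] (b : OrthonormalBasis ι ℝ V)
    (hJ : D.Swaps v₁ v₂) (horth : v₁ ⟂ v₂) (hsum : v₁ ⊔ v₂ = ⊤) (p : V × Z × ℝ) :
    ∑ i, ⟪b i, p.2.2⁻¹ • (
        (2 * ⟪v₂.starProjection p.1, v₂.starProjection (b i)⟫_ℝ) • v₂.starProjection p.1 +
        (2 * quarticA v₂ p) • v₂.starProjection (b i) +
        (2 : ℝ) • D.J (D.quarticB v₁ v₂ p) (v₂.starProjection (b i)) -
        D.J (D.bracket (v₁.starProjection (b i)) (v₂.starProjection p.1) +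
          D.bracket (v₁.starProjection p.1) (v₂.starProjection (b i)))
            (v₂.starProjection p.1))⟫_ℝ =
      p.2.2⁻¹ * ((2 + Module.finrank ℝ Z) * ‖v₂.starProjection p.1‖ ^ 2 +
        2 * quarticA v₂ p * Module.finrank ℝ v₂) := by
  set x := v₁.starProjection p.1
  set y := v₂.starProjection p.1
  have hx : x ∈ v₁ := v₁.starProjection_apply_mem p.1
  have hy : y ∈ v₂ := v₂.starProjection_apply_mem p.1
  have hterm : ∀ u, ⟪u, p.2.2⁻¹ • (
        (2 * ⟪y, v₂.starProjection u⟫_ℝ) • y +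
        (2 * quarticA v₂ p) • v₂.starProjection u +
        (2 : ℝ) • D.J (D.quarticB v₁ v₂ p) (v₂.starProjection u) -
        D.J (D.bracket (v₁.starProjection u) y + D.bracket x (v₂.starProjection u)) y)⟫_ℝ =
      p.2.2⁻¹ * (2 * (⟪y, u⟫_ℝ * ⟪u, y⟫_ℝ) +
        2 * quarticA v₂ p * ⟪u, v₂.starProjection u⟫_ℝ +
        2 * ⟪u, D.J (D.quarticB v₁ v₂ p) (v₂.starProjection u)⟫_ℝ +
        ⟪D.bracket y u, D.bracket y u⟫_ℝ - ⟪D.bracket x u, D.bracket y u⟫_ℝ) := fun u => by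
    -- Brackets within v₂ and within v₁ vanish, so the projections of u can be dropped; then
    -- `sum_inner_bracket` applies.
    have h₁ : D.bracket y (v₁.starProjection u) = D.bracket y u := by
      conv_rhs => rw [← horth.starProjection_add_starProjection hsum u, bracket_add_right,
        D.bracket_eq_zero horth.symm hJ.2 hy (v₂.starProjection_apply_mem u), add_zero]
    have h₂ : D.bracket x (v₂.starProjection u) = D.bracket x u := by
      conv_rhs => rw [← horth.starProjection_add_starProjection hsum u, bracket_add_right,
        D.bracket_eq_zero horth hJ.1 hx (v₁.starProjection_apply_mem u), zero_add]
    have h₃ : ⟪y, v₂.starProjection u⟫_ℝ = ⟪y, u⟫_ℝ := by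
      rw [← inner_starProjection_comm, v₂.starProjection_eq_self_iff.2 hy]
    rw [D.bracket_swap (v₁.starProjection u), h₁, h₂, h₃, real_inner_smul_right, inner_sub_right,
      inner_add_right, inner_add_right, real_inner_smul_right, real_inner_smul_right,
      real_inner_smul_right, real_inner_comm (D.J (-D.bracket y u + D.bracket x u) y) u,
      ← inner_bracket_right, inner_add_left, inner_neg_left]
    ring
  simp_rw [hterm]
  rw [← Finset.mul_sum]
  simp only [Finset.sum_add_distrib, Finset.sum_sub_distrib, ← Finset.mul_sum,
    b.sum_inner_mul_inner, sum_inner_J_starProjection b hJ horth,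
    Submodule.sum_inner_starProjection, sum_inner_bracket, horth.inner_eq hx hy]
  rw [real_inner_self_eq_norm_sq]
  ring

/-- The term in ‖Π₂v‖²/(2t) is the obstruction to isoparametricity; its coefficient becomes 2(m - 1)
when dim v₁ = dim v₂. -/
theorem laplacian_quarticF (hJ : D.Swaps v₁ v₂) (horth : v₁ ⟂ v₂) (hsum : v₁ ⊔ v₂ = ⊤)
    {p : V × Z × ℝ} (hp : p ∈ halfSpace V Z) :
    Riem.laplacian D.metric (coords V Z) (D.quarticF v₁ v₂) p =
      (Module.finrank ℝ V + 2 * Module.finrank ℝ Z + 4) * D.quarticF v₁ v₂ p +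
      (2 * Module.finrank ℝ Z - 2 + 2 * Module.finrank ℝ v₂ - Module.finrank ℝ V) *
        (‖v₂.starProjection p.1‖ ^ 2 / (2 * p.2.2)) +
      (2 * Module.finrank ℝ v₂ - Module.finrank ℝ V - 4) := by
  have hp' : p.2.2 ≠ 0 := (show 0 < p.2.2 from hp).ne'
  obtain ⟨LA, hA, hA'⟩ := hasFDerivAt_quarticA (Z := Z) v₂ p
  obtain ⟨LB, hB, hB'⟩ := D.hasFDerivAt_quarticB v₁ v₂ p
  obtain ⟨LV, hV, hV₁, hV₂⟩ := hasFDerivAt_gradFst hJ horth hp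
  have hF : HasFDerivAt (D.quarticF v₁ v₂) (fderiv ℝ (D.quarticF v₁ v₂) p) p :=
    (((D.contDiffOn_quarticF v₁ v₂ (n := 1)).differentiableOn one_ne_zero).differentiableAt
      (isOpen_halfSpace.mem_nhds hp)).hasFDerivAt
  have hfst : HasFDerivAt (fun q : V × Z × ℝ => q.1) (ContinuousLinearMap.fst ℝ V (Z × ℝ)) p :=
    (ContinuousLinearMap.fst ℝ V (Z × ℝ)).hasFDerivAt
  have hG₂ := (hB.const_smul (2 : ℝ)).sub
    ((D.bracketL.hasFDerivAt_of_bilinear hV hfst).const_smul (1 / 2 : ℝ))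
  have hG₃ := (hA.const_mul 2).sub ((hF.const_mul 2).mul (hasFDerivAt_height p))
  have hG : HasFDerivAt (D.gradF v₁ v₂) _ p := hV.prodMk (hG₂.prodMk hG₃)
  rw [D.laplacian_eq hp (fun q hq => D.gradient_quarticF horth hsum hq) hG]
  have hZ : ∀ w : Z, ‖w‖ = 1 → ⟪w, D.bracket (D.J w (v₂.starProjection p.1)) p.1⟫_ℝ =
      -‖v₂.starProjection p.1‖ ^ 2 := fun w hw => by
    rw [inner_bracket_right, J_J, hw, real_inner_smul_left,
      ← v₂.starProjection_eq_self_iff.2 (v₂.starProjection_apply_mem p.1),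
      inner_starProjection_comm, v₂.starProjection_eq_self_iff.2 (v₂.starProjection_apply_mem p.1),
      real_inner_self_eq_norm_sq]
    ring
  have e₁ := sum_inner_gradFst (stdOrthonormalBasis ℝ V) hJ horth hsum p
  simp only [ContinuousLinearMap.prod_apply, hV₁, e₁]
  have e₂ : ∀ j, ⟪stdOrthonormalBasis ℝ Z j, (((2 : ℝ) • LB - (1 / 2 : ℝ) •
      ((D.bracketL.precompR (V × Z × ℝ)) (D.gradFst v₁ v₂ p) (ContinuousLinearMap.fst ℝ V (Z × ℝ)) +
        (D.bracketL.precompL (V × Z × ℝ)) LV p.1)) (0, stdOrthonormalBasis ℝ Z j, 0))⟫_ℝ =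
      2 + p.2.2⁻¹ * ‖v₂.starProjection p.1‖ ^ 2 := fun j => by
    simp [hB', hV₂, bracketL_apply, bracket_zero_left, bracket_zero_right, inner_sub_right,
      real_inner_smul_right, hZ]
    ring
  simp only [e₂]
  have e₃ : fderiv ℝ (D.quarticF v₁ v₂) p (0, 0, 1) =
      2 * quarticA v₂ p / p.2.2 ^ 2 - 2 * D.quarticF v₁ v₂ p / p.2.2 := by
    rw [fderiv_quarticF _ _ _ hp]; simp [bracket_zero_left, bracket_zero_right]
  have hy : ‖v₂.starProjection p.1‖ ^ 2 = 2 * (quarticA v₂ p - p.2.2) := by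
    rw [quarticA]; ring
  simp [hA', e₃, gradF, hy]
  field_simp
  ring

/-! ### The isoparametric case -/

theorem J_injective (D : DamekRicci V Z) {z : Z} (hz : z ≠ 0) : Function.Injective (D.J z) := by
  refine (injective_iff_map_eq_zero _).2 fun v hv => ?_
  have h := D.norm_J z v
  rw [hv, norm_zero, eq_comm, mul_eq_zero, norm_eq_zero, norm_eq_zero] at h
  exact h.resolve_left hz

theorem finrank_le_of_J_mem {W W' : Submodule ℝ V} {z : Z} (hz : z ≠ 0)
    (h : ∀ v ∈ W, D.J z v ∈ W') : Module.finrank ℝ W ≤ Module.finrank ℝ W' :=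
  LinearMap.finrank_le_finrank_of_injective (f := (D.J z).restrict h) fun _ _ hxy =>
    Subtype.ext (D.J_injective hz (congrArg Subtype.val hxy))

theorem finrank_eq_of_swaps (hJ : D.Swaps v₁ v₂) {z : Z} (hz : z ≠ 0) :
    Module.finrank ℝ v₁ = Module.finrank ℝ v₂ :=
  le_antisymm (finrank_le_of_J_mem hz (hJ.1 z)) (finrank_le_of_J_mem hz (hJ.2 z))

theorem isIsoparametric_of_swaps (hJ : D.Swaps v₁ v₂) (horth : v₁ ⟂ v₂) (hsum : v₁ ⊔ v₂ = ⊤)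
    (hZ : Module.finrank ℝ Z = 1) : D.IsIsoparametric (D.quarticF v₁ v₂) := by
  refine ⟨isTransnormal_of_swaps hJ horth hsum,
    -- The general formula with m = 1 and n = 2 dim v₂.
    fun c => (Module.finrank ℝ V + 6) * c - 4, ?_, fun p hp => ?_⟩
  · fun_prop
  · have : Nontrivial Z := Module.nontrivial_of_finrank_pos (R := ℝ) (by omega)
    obtain ⟨z, hz⟩ := exists_ne (0 : Z)
    have h := horth.finrank_add_finrank hsum
    rw [finrank_eq_of_swaps hJ hz] at h
    have h' : (Module.finrank ℝ V : ℝ) = 2 * Module.finrank ℝ v₂ := by rw [← h]; push_cast; ring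
    rw [laplacian_quarticF hJ horth hsum hp, hZ, h']
    push_cast
    ring

/-- For 0 ≠ y ∈ v₂ choose w such that F agrees at (y, 0, 1) and (0, w, 1). The Laplacians there
differ by (m - 1)‖y‖², which must be zero. -/
theorem finrank_eq_one_of_isIsoparametric (horth : v₁ ⟂ v₂) (hsum : v₁ ⊔ v₂ = ⊤)
    (hZ : Module.finrank ℝ Z ≠ 0) (hV : Module.finrank ℝ V ≠ 0)
    (h : D.IsIsoparametric (D.quarticF v₁ v₂)) : Module.finrank ℝ Z = 1 := by
  have hJ := swaps_of_isTransnormal horth hsum h.1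
  obtain ⟨-, α, -, hα⟩ := h
  have : Nontrivial Z := Module.nontrivial_of_finrank_pos (R := ℝ) (by omega)
  obtain ⟨z, hz⟩ := exists_ne (0 : Z)
  have hn := horth.finrank_add_finrank hsum
  rw [finrank_eq_of_swaps hJ hz] at hn
  have hn' : (Module.finrank ℝ V : ℝ) = 2 * Module.finrank ℝ v₂ := by rw [← hn]; push_cast; ring
  have : Nontrivial v₂ := Module.nontrivial_of_finrank_pos (R := ℝ) (by omega)
  obtain ⟨⟨y, hy⟩, hy0⟩ := exists_ne (0 : v₂)
  have hy0' : 0 < ‖y‖ := norm_pos_iff.2 fun h0 => hy0 (Subtype.ext h0)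
  obtain ⟨w, hw⟩ := exists_quarticF_eq (D := D) horth hz
    (one_le_quarticF (D := D) (v₁ := v₁) (v₂ := v₂) (mem_halfSpace_one y 0))
  have h₁ := hα _ (mem_halfSpace_one y 0)
  rw [← hw, ← hα _ (mem_halfSpace_one 0 w), laplacian_quarticF hJ horth hsum (mem_halfSpace_one y 0),
    laplacian_quarticF hJ horth hsum (mem_halfSpace_one 0 w), hw, hn',
    v₂.starProjection_eq_self_iff.2 hy, map_zero, norm_zero] at h₁
  have h₂ : ((Module.finrank ℝ Z : ℝ) - 1) * ‖y‖ ^ 2 = 0 := by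
    ring_nf at h₁ ⊢
    linarith
  have h₃ := (mul_eq_zero.1 h₂).resolve_right (by positivity)
  exact_mod_cast sub_eq_zero.1 h₃

/-- A maximal totally real subspace of `ℂH^k` and its orthogonal complement are interchanged by
the Clifford action. -/
theorem swaps_of_isMaximalTotallyReal (horth : v₁ ⟂ v₂) (hsum : v₁ ⊔ v₂ = ⊤) {k : ℕ}
    (e : D.Iso (complexHyperbolic k)) (h : IsMaximalTotallyReal e v₁) : D.Swaps v₁ v₂ := by
  have hreal : ∀ z : Z, ∀ x ∈ v₁, ∀ y ∈ v₁, ⟪D.J z x, y⟫_ℝ = 0 := fun z x hx y hy => by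
    rw [← e.mapV.inner_map_map, e.map_J, complexHyperbolic_J, real_inner_smul_left]
    exact mul_eq_zero_of_right _
      (h.prop _ (Submodule.mem_map_of_mem hx) _ (Submodule.mem_map_of_mem hy))
  have h₁ : ∀ z : Z, ∀ v ∈ v₁, D.J z v ∈ v₂ := fun z x hx =>
    horth.mem_of_forall_inner_eq_zero hsum fun y hy => by
      rw [real_inner_comm, hreal z x hx y hy]
  set i := e.mapZ.symm 1 with hi
  have hei : ∀ v, e.mapV (D.J i v) = Complex.I • e.mapV v := fun v => by
    rw [e.map_J, complexHyperbolic_J, hi, e.mapZ.apply_symm_apply, one_smul]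
  -- Such a y could be adjoined to v₁ without losing total reality, so maximality puts it in v₁ ∩ v₂
  -- = 0.
  have hmem : ∀ y ∈ v₂, (∀ x ∈ v₁, ⟪D.J i x, y⟫_ℝ = 0) → y = 0 := fun y hy hxy => by
    have htr : IsTotallyReal ((v₁ ⊔ Submodule.span ℝ {y}).map
        e.mapV.toLinearEquiv.toLinearMap) := by
      rintro _ ⟨a', ha', rfl⟩ _ ⟨b', hb', rfl⟩
      obtain ⟨a, ha, _, hc, rfl⟩ := Submodule.mem_sup.1 ha'
      obtain ⟨b, hb, _, hd, rfl⟩ := Submodule.mem_sup.1 hb'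
      obtain ⟨c, rfl⟩ := Submodule.mem_span_singleton.1 hc
      obtain ⟨d, rfl⟩ := Submodule.mem_span_singleton.1 hd
      change ⟪Complex.I • e.mapV (a + c • y), e.mapV (b + d • y)⟫_ℝ = 0
      rw [← hei, e.mapV.inner_map_map]
      have hya : ⟪D.J i y, b⟫_ℝ = 0 := by rw [inner_J_left, real_inner_comm, hxy b hb, neg_zero]
      simp [inner_add_left, inner_add_right, real_inner_smul_left, real_inner_smul_right,
        hreal i a ha b hb, hxy a ha, hya, inner_J_self]
    have hle := h.le_of_ge htr (Submodule.map_mono le_sup_left)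
    have hy₁ : y ∈ v₁ := by
      obtain ⟨a, ha, hay⟩ := hle (Submodule.mem_map_of_mem
        (Submodule.mem_sup_right (Submodule.mem_span_singleton_self y)))
      rwa [← e.mapV.injective hay]
    exact inner_self_eq_zero.1 (horth.inner_eq hy₁ hy)
  have hni : ‖i‖ = 1 := by rw [hi, e.mapZ.symm.norm_map, norm_one]
  have hiv : ∀ y ∈ v₂, D.J i y ∈ v₁ := fun y hy => by
    -- Since J_i is orthogonal with square -1, -J_iΠ₁J_i is the projection onto J_i v₁. The left
    -- side is thus the part of y orthogonal to J_i v₁, and it lies in v₂.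
    have h0 : y + D.J i (v₁.starProjection (D.J i y)) = 0 := by
      refine hmem _ (v₂.add_mem hy (h₁ _ _ (v₁.starProjection_apply_mem _))) fun x hx => ?_
      rw [inner_add_right, inner_J_J, hni, inner_J_left, ← inner_starProjection_comm,
        v₁.starProjection_eq_self_iff.2 hx]
      ring
    have h1 := congrArg (D.J i) h0
    rw [map_add, J_J, hni, map_zero] at h1
    have h2 : D.J i y = v₁.starProjection (D.J i y) := by
      rw [← sub_eq_zero, ← h1]; module
    rw [h2]
    exact v₁.starProjection_apply_mem _
  refine ⟨h₁, fun z y hy => ?_⟩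
  have hz : z = e.mapZ z • i := by
    apply e.mapZ.injective
    rw [map_smul, hi, e.mapZ.apply_symm_apply, smul_eq_mul, mul_one]
  rw [hz, map_smul, LinearMap.smul_apply]
  exact v₁.smul_mem _ (hiv y hy)

/-- The real linear map `ℂ^d → V`, `a + i b ↦ ∑ a_j e_j + J (∑ b_j e_j)`. -/
def complexify {d : ℕ} (b : Fin d → V) (j : V →ₗ[ℝ] V) : EuclideanSpace ℂ (Fin d) →ₗ[ℝ] V where
  toFun w := ∑ l, (w l).re • b l + j (∑ l, (w l).im • b l)
  map_add' w w' := by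
    simp only [PiLp.add_apply, Complex.add_re, Complex.add_im, add_smul, Finset.sum_add_distrib,
      map_add]
    abel
  map_smul' c w := by
    simp only [PiLp.smul_apply, Complex.smul_re, Complex.smul_im, smul_eq_mul, mul_smul,
      ← Finset.smul_sum, map_smul, RingHom.id_apply, smul_add]

/-- A Damek–Ricci space with one-dimensional centre is complex hyperbolic. -/
theorem exists_iso_complexHyperbolic (hJ : D.Swaps v₁ v₂) (horth : v₁ ⟂ v₂) (hsum : v₁ ⊔ v₂ = ⊤)
    (hZ : Module.finrank ℝ Z = 1) :
    ∃ e : D.Iso (complexHyperbolic (Module.finrank ℝ v₁ + 1)), IsMaximalTotallyReal e v₁ := by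
  have : Nontrivial Z := Module.nontrivial_of_finrank_pos (R := ℝ) (by omega)
  obtain ⟨i, hi⟩ := exists_norm_eq Z zero_le_one
  let ψ₀ : ℝ →ₗᵢ[ℝ] Z := LinearIsometry.toSpanSingleton ℝ Z hi
  have hψ₀ : Function.Surjective ψ₀ := by
    have := (LinearMap.injective_iff_surjective_of_finrank_eq_finrank
      (f := ψ₀.toLinearMap) (by rw [hZ, Module.finrank_self])).1 ψ₀.injective
    exact this
  let ψ : ℝ ≃ₗᵢ[ℝ] Z := LinearIsometryEquiv.ofSurjective ψ₀ hψ₀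
  have hψ : ∀ c, ψ c = c • i := fun c => rfl
  let b := stdOrthonormalBasis ℝ v₁
  let φ₀ := complexify (fun l => (b l : V)) (D.J i)
  have hsum_mem : ∀ c : Fin (Module.finrank ℝ v₁) → ℝ, ∑ l, c l • (b l : V) ∈ v₁ := fun c =>
    v₁.sum_mem fun l _ => v₁.smul_mem _ (b l).2
  have hsum_norm : ∀ c : Fin (Module.finrank ℝ v₁) → ℝ, ‖∑ l, c l • (b l : V)‖ ^ 2 =
      ∑ l, c l ^ 2 := fun c => by
    have h : ∑ l, c l • (b l : V) = ((∑ l, c l • b l : v₁) : V) := by simp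
    rw [h, ← Submodule.coe_norm, ← real_inner_self_eq_norm_sq, b.orthonormal.inner_sum]
    simp [sq]
  have hnorm : ∀ w, ‖φ₀ w‖ = ‖w‖ := fun w => by
    have h : ‖φ₀ w‖ ^ 2 = ‖w‖ ^ 2 := by
      change ‖∑ l, (w l).re • (b l : V) + D.J i (∑ l, (w l).im • (b l : V))‖ ^ 2 = _
      rw [sq, norm_add_sq_eq_norm_sq_add_norm_sq_real
        (horth.inner_eq (hsum_mem _) (hJ.1 i _ (hsum_mem _))), norm_J, hi, one_mul, ← sq, ← sq,
        hsum_norm, hsum_norm, EuclideanSpace.norm_sq_eq, ← Finset.sum_add_distrib]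
      refine Finset.sum_congr rfl fun l _ => ?_
      rw [Complex.sq_norm, Complex.normSq_apply]; ring
    exact (sq_eq_sq₀ (norm_nonneg _) (norm_nonneg _)).1 h
  have hexp : ∀ (x : V) (hx : x ∈ v₁), ∑ l, (b.repr ⟨x, hx⟩ l) • (b l : V) = x := fun x hx => by
    have := congrArg Subtype.val (b.sum_repr ⟨x, hx⟩)
    simpa using this
  have hsurj : Function.Surjective φ₀ := fun v => by
    have hx := v₁.starProjection_apply_mem v
    have hy := hJ.2 i _ (v₂.starProjection_apply_mem v)
    -- With v = x + y and y = J_i(-J_i y), the real parts are the coordinates of x and the imaginary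
    -- parts those of -J_i y ∈ v₁.
    refine ⟨WithLp.toLp 2 fun l => ⟨b.repr ⟨_, hx⟩ l, -b.repr ⟨_, hy⟩ l⟩, ?_⟩
    change ∑ l, (b.repr ⟨_, hx⟩ l) • (b l : V) + D.J i (∑ l, (-b.repr ⟨_, hy⟩ l) • (b l : V)) = v
    simp only [neg_smul, Finset.sum_neg_distrib]
    rw [hexp _ hx, hexp _ hy, map_neg, J_J, hi]
    conv_rhs => rw [← horth.starProjection_add_starProjection hsum v]
    module
  let φ : EuclideanSpace ℂ (Fin (Module.finrank ℝ v₁)) ≃ₗᵢ[ℝ] V :=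
    LinearIsometryEquiv.ofSurjective ⟨φ₀, hnorm⟩ hsurj
  have hφ : ∀ w, φ w = ∑ l, (w l).re • (b l : V) + D.J i (∑ l, (w l).im • (b l : V)) :=
    fun w => rfl
  have hφI : ∀ w, φ (Complex.I • w) = D.J i (φ w) := fun w => by
    rw [hφ, hφ, map_add, J_J, hi]
    simp
    abel
  let e : D.Iso (complexHyperbolic (Module.finrank ℝ v₁ + 1)) :=
    { mapV := φ.symm
      mapZ := ψ.symm
      map_J := fun z v => by
        apply φ.injective
        rw [complexHyperbolic_J]
        change _ = φ (ψ.symm z • Complex.I • φ.symm v)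
        rw [map_smul, hφI, φ.apply_symm_apply]
        rw [φ.apply_symm_apply]
        conv_lhs => rw [← ψ.apply_symm_apply z, hψ, map_smul, LinearMap.smul_apply] }
  have hI : ∀ a b : V, ⟪Complex.I • φ.symm a, φ.symm b⟫_ℝ = ⟪D.J i a, b⟫_ℝ := fun a b => by
    rw [← φ.inner_map_map, hφI, φ.apply_symm_apply, φ.apply_symm_apply]
  refine ⟨e, ?_, fun W hW hle => ?_⟩
  · rintro _ ⟨x, hx, rfl⟩ _ ⟨y, hy, rfl⟩
    refine (hI x y).trans (horth.symm.inner_eq (hJ.1 i x hx) hy)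
  · intro w hw
    refine ⟨φ w, ?_, φ.symm_apply_apply w⟩
    refine horth.symm.mem_of_forall_inner_eq_zero (by rwa [sup_comm]) fun y hy => ?_
    -- Total reality of W, tested on J_i y ∈ v₁ with y ∈ v₂, says ⟨J_i J_i y, φ w⟩ = -⟨y, φ w⟩ = 0.
    -- So φ w ⟂ v₂, that is φ w ∈ v₁.
    have h := hW _ (hle ⟨D.J i y, hJ.2 i y hy, rfl⟩) _ hw
    have h' := hI (D.J i y) (φ w)
    rw [φ.symm_apply_apply, J_J, hi] at h'
    have h'' : ⟪(-(1 : ℝ) ^ 2) • y, φ w⟫_ℝ = 0 := h'.symm.trans h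
    rw [real_inner_smul_left] at h''
    linarith

theorem isIsoparametric_iff (horth : v₁ ⟂ v₂) (hsum : v₁ ⊔ v₂ = ⊤)
    (hZ : Module.finrank ℝ Z ≠ 0) (hV : Module.finrank ℝ V ≠ 0 ∨ Module.finrank ℝ Z = 1) :
    D.IsIsoparametric (D.quarticF v₁ v₂) ↔
      ∃ k : ℕ, 1 ≤ k ∧ ∃ e : D.Iso (complexHyperbolic k), IsMaximalTotallyReal e v₁ := by
  constructor
  · intro h
    -- For n = 0 the obstructing term vanishes identically and the Laplacian says nothing about m;
    -- hence the separate alternative.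
    have h₁ : Module.finrank ℝ Z = 1 :=
      hV.elim (fun hV => finrank_eq_one_of_isIsoparametric horth hsum hZ hV h) id
    exact ⟨_, Nat.le_add_left _ _,
      exists_iso_complexHyperbolic (swaps_of_isTransnormal horth hsum h.1) horth hsum h₁⟩
  · rintro ⟨k, -, e, he⟩
    exact isIsoparametric_of_swaps (swaps_of_isMaximalTotallyReal horth hsum e he) horth hsum
      (by rw [e.mapZ.toLinearEquiv.finrank_eq, Module.finrank_self])

/-! ### Lengths and distances -/

/-- The `C¹` curves `[0,1] → V × Z × ℝ` in the half-space. -/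
def IsCurve (γ : ℝ → V × Z × ℝ) : Prop :=
  ContDiffOn ℝ 1 γ (Set.Icc 0 1) ∧ ∀ s ∈ Set.Icc (0 : ℝ) 1, γ s ∈ halfSpace V Z

theorem IsCurve.hasDerivWithinAt {γ : ℝ → V × Z × ℝ} (hγ : IsCurve γ) {s : ℝ}
    (hs : s ∈ Set.Icc (0 : ℝ) 1) :
    HasDerivWithinAt γ (derivWithin γ (Set.Icc 0 1) s) (Set.Icc 0 1) s :=
  ((hγ.1.differentiableOn one_ne_zero) s hs).hasDerivWithinAt

theorem IsCurve.continuousOn_speed (D : DamekRicci V Z) {γ : ℝ → V × Z × ℝ} (hγ : IsCurve γ) :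
    ContinuousOn (fun s => √(D.metric (γ s) (derivWithin γ (Set.Icc 0 1) s)
      (derivWithin γ (Set.Icc 0 1) s))) (Set.Icc 0 1) := by
  have h₁ : ContinuousOn γ (Set.Icc 0 1) := hγ.1.continuousOn
  have h₂ : ContinuousOn (derivWithin γ (Set.Icc 0 1)) (Set.Icc 0 1) :=
    hγ.1.continuousOn_derivWithin (uniqueDiffOn_Icc one_pos) le_rfl
  have h₀ : ∀ s ∈ Set.Icc (0 : ℝ) 1, (γ s).2.2 ≠ 0 := fun s hs =>
    (show 0 < (γ s).2.2 from hγ.2 s hs).ne'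
  have h₀' : ∀ s ∈ Set.Icc (0 : ℝ) 1, (γ s).2.2 ^ 2 ≠ 0 := fun s hs => pow_ne_zero 2 (h₀ s hs)
  simp only [metric, ← bracketL_apply]
  fun_prop (disch := assumption)

theorem IsCurve.intervalIntegrable_speed (D : DamekRicci V Z) {γ : ℝ → V × Z × ℝ}
    (hγ : IsCurve γ) :
    IntervalIntegrable (fun s => √(D.metric (γ s) (derivWithin γ (Set.Icc 0 1) s)
      (derivWithin γ (Set.Icc 0 1) s))) MeasureTheory.volume 0 1 :=
  ContinuousOn.intervalIntegrable_of_Icc zero_le_one (hγ.continuousOn_speed D)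

theorem curveLength_nonneg (D : DamekRicci V Z) (γ : ℝ → V × Z × ℝ) :
    0 ≤ Riem.curveLength D.metric γ :=
  intervalIntegral.integral_nonneg zero_le_one fun _ _ => Real.sqrt_nonneg _

theorem dist_le_curveLength (D : DamekRicci V Z) {γ : ℝ → V × Z × ℝ} (hγ : IsCurve γ) :
    D.dist (γ 0) (γ 1) ≤ Riem.curveLength D.metric γ :=
  csInf_le ⟨0, by rintro _ ⟨γ, -, -, -, -, rfl⟩; exact curveLength_nonneg D γ⟩
    ⟨γ, hγ.1, hγ.2, rfl, rfl, rfl⟩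

/-- The real infimum of the empty set is 0, so a lower bound needs some admissible curve: the
straight segment, which stays in the convex half-space. -/
theorem le_dist (D : DamekRicci V Z) {p q : V × Z × ℝ} (hp : p ∈ halfSpace V Z)
    (hq : q ∈ halfSpace V Z) {c : ℝ}
    (h : ∀ γ, IsCurve γ → γ 0 = p → γ 1 = q → c ≤ Riem.curveLength D.metric γ) :
    c ≤ D.dist p q := by
  refine le_csInf ⟨_, fun s : ℝ => AffineMap.lineMap p q s, ?_, fun s hs => ?_, ?_, ?_, rfl⟩ ?_
  · simp only [AffineMap.lineMap_apply_module']
    fun_prop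
  · have hp' : 0 < p.2.2 := hp
    have hq' : 0 < q.2.2 := hq
    change 0 < (AffineMap.lineMap p q s).2.2
    simp only [AffineMap.lineMap_apply_module, Prod.snd_add, Prod.smul_snd, smul_eq_mul]
    rcases hs.1.eq_or_lt with rfl | h0
    · simpa
    · exact add_pos_of_nonneg_of_pos (mul_nonneg (by linarith [hs.2]) hp'.le) (mul_pos h0 hq')
  · simp
  · simp
  · rintro _ ⟨γ, h₁, h₂, h₃, h₄, rfl⟩
    exact h γ ⟨h₁, h₂⟩ h₃ h₄

/-- A linear map that does not increase the lengths of tangent vectors does not increase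
distances. -/
theorem dist_map_le {V' Z' : Type*} [NormedAddCommGroup V'] [InnerProductSpace ℝ V']
    [FiniteDimensional ℝ V'] [NormedAddCommGroup Z'] [InnerProductSpace ℝ Z']
    [FiniteDimensional ℝ Z'] (D : DamekRicci V Z) (D' : DamekRicci V' Z')
    (L : V × Z × ℝ →L[ℝ] V' × Z' × ℝ) (hL : ∀ p ∈ halfSpace V Z, L p ∈ halfSpace V' Z')
    (hg : ∀ p ∈ halfSpace V Z, ∀ X, D'.metric (L p) (L X) (L X) ≤ D.metric p X X)
    {p q : V × Z × ℝ} (hp : p ∈ halfSpace V Z) (hq : q ∈ halfSpace V Z) :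
    D'.dist (L p) (L q) ≤ D.dist p q := by
  refine D.le_dist hp hq fun γ hγ h0 h1 => ?_
  have hγ' : IsCurve (fun s => L (γ s)) :=
    ⟨L.contDiff.comp_contDiffOn hγ.1, fun s hs => hL _ (hγ.2 s hs)⟩
  have h := D'.dist_le_curveLength hγ'
  rw [h0, h1] at h
  refine h.trans (intervalIntegral.integral_mono_on zero_le_one (hγ'.intervalIntegrable_speed D')
    (hγ.intervalIntegrable_speed D) fun s hs => Real.sqrt_le_sqrt ?_)
  have hd : derivWithin (fun s => L (γ s)) (Set.Icc 0 1) s = L (derivWithin γ (Set.Icc 0 1) s) :=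
    (L.hasFDerivAt.comp_hasDerivWithinAt s (hγ.hasDerivWithinAt hs)).derivWithin
      (uniqueDiffOn_Icc one_pos s hs)
  rw [hd]
  exact hg _ (hγ.2 s hs) _

theorem metric_realHyperbolic (k : ℕ) (p X : EuclideanSpace ℝ (Fin (k - 1)) ×
    EuclideanSpace ℝ (Fin 0) × ℝ) :
    (realHyperbolic k).metric p X X = 1 / p.2.2 * ‖X.1‖ ^ 2 + X.2.2 * X.2.2 / p.2.2 ^ 2 := by
  rw [metric, real_inner_self_eq_norm_sq, Subsingleton.elim (X.2.1 + _) 0, inner_zero_left,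
    mul_zero, add_zero]

/-- Brackets within v₁ vanish, so the inclusion f preserves lengths of tangent vectors. The
projection π only discards non-negative terms of the metric, so it does not increase them. As π ∘ f
= id, distances are preserved even though curves may leave the slice. -/
theorem isRealHyperbolicSubspace_slice (hJ : D.Swaps v₁ v₂) (horth : v₁ ⟂ v₂) {k : ℕ}
    (hk : Module.finrank ℝ v₁ = k - 1) : D.IsRealHyperbolicSubspace k (slice Z v₁) := by
  let φ : v₁ ≃ₗᵢ[ℝ] EuclideanSpace ℝ (Fin (k - 1)) :=
    ((stdOrthonormalBasis ℝ v₁).reindex (finCongr hk)).repr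
  let f : EuclideanSpace ℝ (Fin (k - 1)) × EuclideanSpace ℝ (Fin 0) × ℝ →L[ℝ] V × Z × ℝ :=
    ((v₁.subtypeL.comp (φ.symm.toContinuousLinearEquiv : _ →L[ℝ] v₁)).comp
      (ContinuousLinearMap.fst ℝ _ _)).prod
      ((0 : _ →L[ℝ] Z).prod
        ((ContinuousLinearMap.snd ℝ _ _).comp (ContinuousLinearMap.snd ℝ _ _)))
  let π : V × Z × ℝ →L[ℝ] EuclideanSpace ℝ (Fin (k - 1)) × EuclideanSpace ℝ (Fin 0) × ℝ :=
    (((φ.toContinuousLinearEquiv : v₁ →L[ℝ] _).comp v₁.orthogonalProjectionOnto).comp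
      (ContinuousLinearMap.fst ℝ _ _)).prod
      ((0 : _ →L[ℝ] EuclideanSpace ℝ (Fin 0)).prod
        ((ContinuousLinearMap.snd ℝ _ _).comp (ContinuousLinearMap.snd ℝ _ _)))
  have hf : ∀ p, f p = ((φ.symm p.1 : V), 0, p.2.2) := fun p => rfl
  have hπ : ∀ p, π p = (φ (v₁.orthogonalProjectionOnto p.1), 0, p.2.2) := fun p => rfl
  have hπf : ∀ p, π (f p) = p := fun p => by
    rw [hf, hπ]
    ext : 1
    · simp
    · exact Prod.ext (Subsingleton.elim _ _) rfl
  have hfm : ∀ p ∈ halfSpace _ _, f p ∈ halfSpace V Z := fun p hp => hp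
  refine ⟨f, ?_, fun p hp q hq => le_antisymm ?_ ?_⟩
  · ext ⟨v, z, t⟩
    constructor
    · rintro ⟨p, hp, h⟩
      rw [← h, hf]
      exact ⟨hp, (φ.symm p.1).2, rfl⟩
    · rintro ⟨ht, hv, hz⟩
      refine ⟨(φ ⟨v, hv⟩, 0, t), ht, ?_⟩
      rw [hf]
      simp only [LinearIsometryEquiv.symm_apply_apply]
      exact Prod.ext rfl (Prod.ext hz.symm rfl)
  · refine dist_map_le _ D f hfm (fun p hp X => ?_) hp hq
    rw [metric_realHyperbolic, metric, hf, hf]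
    have hn : ‖(φ.symm X.1 : V)‖ = ‖X.1‖ := φ.symm.norm_map X.1
    simp [D.bracket_eq_zero horth hJ.1 (φ.symm X.1).2 (φ.symm p.1).2, hn]
  · have h := dist_map_le D (realHyperbolic k) π (fun p hp => hp) (fun p hp X => ?_)
      (hfm p hp) (hfm q hq)
    · rwa [hπf, hπf] at h
    · have hp' : 0 < p.2.2 := hp
      rw [metric_realHyperbolic, metric, hπ, hπ, real_inner_self_eq_norm_sq,
        real_inner_self_eq_norm_sq, LinearIsometryEquiv.norm_map]
      have h₁ : ‖v₁.orthogonalProjectionOnto X.1‖ ≤ ‖X.1‖ :=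
        v₁.norm_orthogonalProjectionOnto_apply_le X.1
      have h₂ : 0 ≤ 1 / p.2.2 ^ 2 * ‖X.2.1 + (1 / 2 : ℝ) • D.bracket X.1 p.1‖ ^ 2 := by positivity
      have h₃ : 1 / p.2.2 * ‖v₁.orthogonalProjectionOnto X.1‖ ^ 2 ≤ 1 / p.2.2 * ‖X.1‖ ^ 2 := by gcongr
      simp only
      linarith

theorem finrank_of_isMaximalTotallyReal (horth : v₁ ⟂ v₂) (hsum : v₁ ⊔ v₂ = ⊤) {k : ℕ}
    (e : D.Iso (complexHyperbolic k)) (h : IsMaximalTotallyReal e v₁) :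
    Module.finrank ℝ v₁ = k - 1 := by
  have hJ := swaps_of_isMaximalTotallyReal horth hsum e h
  have hz : e.mapZ.symm 1 ≠ 0 := by simp
  have h₁ := horth.finrank_add_finrank hsum
  rw [← finrank_eq_of_swaps hJ hz, e.mapV.toLinearEquiv.finrank_eq, finrank_real_of_complex,
    finrank_euclideanSpace_fin] at h₁
  omega

/-! ### Tubes -/

theorem abs_fderiv_quarticF_le (hJ : D.Swaps v₁ v₂) (horth : v₁ ⟂ v₂) (hsum : v₁ ⊔ v₂ = ⊤)
    {p : V × Z × ℝ} (hp : p ∈ halfSpace V Z) (X : V × Z × ℝ) :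
    |fderiv ℝ (D.quarticF v₁ v₂) p X| ≤
      √(4 * D.quarticF v₁ v₂ p * (D.quarticF v₁ v₂ p - 1)) * √(D.metric p X X) := by
  rw [← D.metric_gradF horth hsum hp, ← metric_gradF_self_of_swaps hJ horth hp]
  exact D.abs_metric_le hp _ _

/-- A curve that ends where `F = 1` has length at least `arsinh √(F - 1)`, evaluated at its
starting point. -/
theorem arsinh_le_curveLength (hJ : D.Swaps v₁ v₂) (horth : v₁ ⟂ v₂) (hsum : v₁ ⊔ v₂ = ⊤)
    {γ : ℝ → V × Z × ℝ} (hγ : IsCurve γ) (h1 : D.quarticF v₁ v₂ (γ 1) = 1) :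
    Real.arsinh √(D.quarticF v₁ v₂ (γ 0) - 1) ≤ Riem.curveLength D.metric γ := by
  set f : ℝ → ℝ := fun s => D.quarticF v₁ v₂ (γ s)
  have hFd : ∀ p ∈ halfSpace V Z, HasFDerivAt (D.quarticF v₁ v₂)
      (fderiv ℝ (D.quarticF v₁ v₂) p) p := fun p hp =>
    (((D.contDiffOn_quarticF v₁ v₂ (n := 1)).differentiableOn one_ne_zero).differentiableAt
      (isOpen_halfSpace.mem_nhds hp)).hasFDerivAt
  have hfc : ContinuousOn f (Set.Icc 0 1) :=
    (D.contDiffOn_quarticF v₁ v₂ (n := 1)).continuousOn.comp hγ.1.continuousOn hγ.2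
  -- The square root is not differentiable where F = 1; the shift by ε avoids this and is removed by
  -- a limit at the end.
  have key : ∀ ε > 0, Real.arsinh √(f 0 - 1 + ε) - Real.arsinh √(f 1 - 1 + ε) ≤
      Riem.curveLength D.metric γ := fun ε hε => by
    have h := intervalIntegral.sub_le_integral_of_hasDeriv_right_of_le
      (g := fun s => -Real.arsinh √(f s - 1 + ε))
      (g' := fun s => -((√(1 + √(f s - 1 + ε) ^ 2))⁻¹ * (fderiv ℝ (D.quarticF v₁ v₂) (γ s)
        (derivWithin γ (Set.Icc 0 1) s) / (2 * √(f s - 1 + ε)))))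
      (zero_le_one' ℝ)
      (by fun_prop : ContinuousOn (fun s => √(f s - 1 + ε)) (Set.Icc 0 1)).arsinh.neg
      (fun s hs => ?_)
      ((hγ.continuousOn_speed D).integrableOn_Icc) (fun s hs => ?_)
    · simp only [sub_neg_eq_add] at h
      rw [neg_add_eq_sub] at h
      exact h
    · have hs' := Set.Ioo_subset_Icc_self hs
      have hd : HasDerivAt γ (derivWithin γ (Set.Icc 0 1) s) s :=
        (hγ.hasDerivWithinAt hs').hasDerivAt (Icc_mem_nhds hs.1 hs.2)
      have hfd : HasDerivAt f _ s := (hFd _ (hγ.2 s hs')).comp_hasDerivAt s hd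
      have hpos : f s - 1 + ε ≠ 0 := by
        have : 1 ≤ f s := one_le_quarticF (hγ.2 s hs')
        linarith
      have := (((hfd.sub_const 1).add_const ε).sqrt hpos).arsinh.neg
      exact this.hasDerivWithinAt
    · have hs' := Set.Ioo_subset_Icc_self hs
      have h1f : 1 ≤ f s := one_le_quarticF (hγ.2 s hs')
      have hb := abs_fderiv_quarticF_le hJ horth hsum (hγ.2 s hs') (derivWithin γ (Set.Icc 0 1) s)
      set dF := fderiv ℝ (D.quarticF v₁ v₂) (γ s) (derivWithin γ (Set.Icc 0 1) s)
      set v := √(D.metric (γ s) (derivWithin γ (Set.Icc 0 1) s) (derivWithin γ (Set.Icc 0 1) s))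
      have hv : 0 ≤ v := Real.sqrt_nonneg _
      have hu : 0 < f s - 1 + ε := by linarith
      -- This is 4f(f - 1) ≤ 4(f + ε)(f - 1 + ε): the shifted function is still 1-Lipschitz along
      -- the curve.
      have hle : √(4 * f s * (f s - 1)) ≤ √(1 + √(f s - 1 + ε) ^ 2) * (2 * √(f s - 1 + ε)) := by
        rw [Real.sq_sqrt hu.le]
        refine Real.sqrt_le_iff.2 ⟨by positivity, ?_⟩
        rw [mul_pow, mul_pow, Real.sq_sqrt hu.le, Real.sq_sqrt (by linarith)]
        nlinarith
      have hden : 0 < √(1 + √(f s - 1 + ε) ^ 2) * (2 * √(f s - 1 + ε)) := by positivity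
      have hb' : -dF ≤ v * (√(1 + √(f s - 1 + ε) ^ 2) * (2 * √(f s - 1 + ε))) :=
        (neg_le_abs dF).trans (hb.trans ((mul_le_mul_of_nonneg_right hle hv).trans_eq
          (mul_comm _ _)))
      rw [← div_le_iff₀ hden] at hb'
      refine le_trans (le_of_eq ?_) hb'
      field_simp
  have hcont : Continuous fun ε : ℝ => Real.arsinh √(f 0 - 1 + ε) - Real.arsinh √(f 1 - 1 + ε) :=
    (by fun_prop : Continuous fun ε : ℝ => √(f 0 - 1 + ε)).arsinh.sub
      (by fun_prop : Continuous fun ε : ℝ => √(f 1 - 1 + ε)).arsinh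
  have hlim := le_of_tendsto ((hcont.tendsto 0).mono_left (nhdsWithin_le_nhds (s := Set.Ioi 0)))
    (Filter.eventually_of_mem self_mem_nhdsWithin key)
  have hf1 : f 1 = 1 := h1
  simpa [hf1] using hlim

/-! ### Curves normal to the slice -/

section NormalCurve

variable (D) (K : Z) (η x₀ : V) (t₀ T : ℝ)

/-- The geodesic that leaves `{(v, 0, t) : v ∈ v₁}` orthogonally at `(x₀, 0, t₀)`, in a rational
parametrization. -/
def normalCurve (s : ℝ) : V × Z × ℝ :=
  (x₀ + (s ^ 2 / (1 + s ^ 2 * ‖K‖ ^ 2)) • D.J K η + (s / (1 + s ^ 2 * ‖K‖ ^ 2)) • η,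
    (s / (1 + s ^ 2 * ‖K‖ ^ 2)) • ((2 * t₀) • K + (1 / 2 : ℝ) • D.bracket x₀ η),
    t₀ * (1 - s ^ 2 * T ^ 2) / (1 + s ^ 2 * ‖K‖ ^ 2))

/-- The velocity of `normalCurve`. -/
def normalCurveVelocity (s : ℝ) : V × Z × ℝ :=
  ((2 * s / (1 + s ^ 2 * ‖K‖ ^ 2) ^ 2) • D.J K η +
      ((1 - s ^ 2 * ‖K‖ ^ 2) / (1 + s ^ 2 * ‖K‖ ^ 2) ^ 2) • η,
    ((1 - s ^ 2 * ‖K‖ ^ 2) / (1 + s ^ 2 * ‖K‖ ^ 2) ^ 2) •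
      ((2 * t₀) • K + (1 / 2 : ℝ) • D.bracket x₀ η),
    -2 * t₀ * s * (T ^ 2 + ‖K‖ ^ 2) / (1 + s ^ 2 * ‖K‖ ^ 2) ^ 2)

theorem contDiff_normalCurve : ContDiff ℝ 1 (D.normalCurve K η x₀ t₀ T) := by
  have h : ∀ s : ℝ, 1 + s ^ 2 * ‖K‖ ^ 2 ≠ 0 := fun s => by positivity
  unfold normalCurve
  fun_prop (disch := assumption)

theorem hasDerivAt_normalCurve (s : ℝ) :
    HasDerivAt (D.normalCurve K η x₀ t₀ T) (D.normalCurveVelocity K η x₀ t₀ T s) s := by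
  have hq : 1 + s ^ 2 * ‖K‖ ^ 2 ≠ 0 := by positivity
  have hs : HasDerivAt (fun s : ℝ => s) 1 s := hasDerivAt_id s
  have hs2 : HasDerivAt (fun s : ℝ => s ^ 2) (2 * s) s :=
    (hs.pow 2).congr_deriv (by simp)
  have hqd : HasDerivAt (fun s : ℝ => 1 + s ^ 2 * ‖K‖ ^ 2) (2 * s * ‖K‖ ^ 2) s :=
    (hs2.mul_const _).const_add 1
  have h₁ : HasDerivAt (fun s : ℝ => s / (1 + s ^ 2 * ‖K‖ ^ 2))
      ((1 - s ^ 2 * ‖K‖ ^ 2) / (1 + s ^ 2 * ‖K‖ ^ 2) ^ 2) s :=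
    (hs.div hqd hq).congr_deriv (by ring)
  have h₂ : HasDerivAt (fun s : ℝ => s ^ 2 / (1 + s ^ 2 * ‖K‖ ^ 2))
      (2 * s / (1 + s ^ 2 * ‖K‖ ^ 2) ^ 2) s :=
    (hs2.div hqd hq).congr_deriv (by ring)
  have h₃ : HasDerivAt (fun s : ℝ => t₀ * (1 - s ^ 2 * T ^ 2) / (1 + s ^ 2 * ‖K‖ ^ 2))
      (-2 * t₀ * s * (T ^ 2 + ‖K‖ ^ 2) / (1 + s ^ 2 * ‖K‖ ^ 2) ^ 2) s :=
    ((((hs2.mul_const (T ^ 2)).const_sub 1).const_mul t₀).div hqd hq).congr_deriv (by ring)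
  exact (((h₂.smul_const _).const_add x₀).add (h₁.smul_const η)).prodMk
    ((h₁.smul_const _).prodMk h₃)

variable {D K η x₀ t₀ T}

/-- The condition `hnorm` ties η, K and T together so that the speed is the derivative of 2
artanh(sT), whatever the direction. -/
theorem metric_normalCurveVelocity (hJ : D.Swaps v₁ v₂) (horth : v₁ ⟂ v₂) (hη : η ∈ v₂)
    (hx₀ : x₀ ∈ v₁) (ht₀ : 0 < t₀) (hnorm : ‖η‖ ^ 2 = 4 * t₀ * (T ^ 2 - ‖K‖ ^ 2)) {s : ℝ}
    (hs : 0 < 1 - s ^ 2 * T ^ 2) :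
    D.metric (D.normalCurve K η x₀ t₀ T s) (D.normalCurveVelocity K η x₀ t₀ T s)
      (D.normalCurveVelocity K η x₀ t₀ T s) = (2 * T / (1 - s ^ 2 * T ^ 2)) ^ 2 := by
  have hq : 1 + s ^ 2 * ‖K‖ ^ 2 ≠ 0 := by positivity
  have hKη : D.J K η ∈ v₁ := hJ.2 K η hη
  have hV : ⟪(D.normalCurveVelocity K η x₀ t₀ T s).1,
      (D.normalCurveVelocity K η x₀ t₀ T s).1⟫_ℝ = ‖η‖ ^ 2 / (1 + s ^ 2 * ‖K‖ ^ 2) ^ 2 := by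
    simp only [normalCurveVelocity, inner_add_left, inner_add_right, real_inner_smul_left,
      real_inner_smul_right, inner_J_J, horth.inner_eq hKη hη, horth.symm.inner_eq hη hKη]
    rw [real_inner_self_eq_norm_sq]
    field_simp
    ring
  -- The ½[x₀, η] in the curve cancels the bracket of η with x₀ from the metric; the brackets of J_K
  -- η with η are multiples of K.
  have hZ : (D.normalCurveVelocity K η x₀ t₀ T s).2.1 + (1 / 2 : ℝ) •
      D.bracket (D.normalCurveVelocity K η x₀ t₀ T s).1 (D.normalCurve K η x₀ t₀ T s).1 =
      (2 * t₀ * (1 - s ^ 2 * T ^ 2) / (1 + s ^ 2 * ‖K‖ ^ 2) ^ 2) • K := by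
    simp only [normalCurveVelocity, normalCurve, bracket_add_left, bracket_add_right,
      bracket_smul_left, bracket_smul_right, D.bracket_eq_zero horth hJ.1 hKη hx₀,
      D.bracket_eq_zero horth hJ.1 hKη hKη, D.bracket_eq_zero horth.symm hJ.2 hη hη,
      D.bracket_swap η x₀, D.bracket_swap η (D.J K η), bracket_J_self, hnorm]
    match_scalars
    · field_simp
      ring
    · field_simp
      ring
  rw [metric, hV, hZ, hnorm, real_inner_smul_left, real_inner_smul_right,
    real_inner_self_eq_norm_sq]
  simp only [normalCurveVelocity, normalCurve]
  field_simp
  ring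

end NormalCurve

theorem integral_two_mul_div_one_sub_sq {T : ℝ} (hT₀ : 0 ≤ T) (hT : T < 1) :
    ∫ s in (0 : ℝ)..1, 2 * T / (1 - s ^ 2 * T ^ 2) = Real.log (1 + T) - Real.log (1 - T) := by
  have hpos : ∀ s ∈ Set.Icc (0 : ℝ) 1, s * T < 1 := fun s hs => by nlinarith [hs.1, hs.2]
  have hpos' : ∀ s ∈ Set.Icc (0 : ℝ) 1, 0 ≤ s * T := fun s hs => mul_nonneg hs.1 hT₀
  have hne : ∀ s ∈ Set.Icc (0 : ℝ) 1, 1 - s ^ 2 * T ^ 2 ≠ 0 := fun s hs => by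
    nlinarith [hpos s hs, hpos' s hs]
  have h := intervalIntegral.integral_eq_sub_of_hasDerivAt (a := (0 : ℝ)) (b := 1)
    (f := fun s => Real.log (1 + s * T) - Real.log (1 - s * T))
    (f' := fun s => 2 * T / (1 - s ^ 2 * T ^ 2)) ?_ ?_
  · simpa using h
  · rw [Set.uIcc_of_le zero_le_one]
    intro s hs
    have h₁ : 1 + s * T ≠ 0 := by linarith [hpos' s hs]
    have h₂ : 1 - s * T ≠ 0 := by linarith [hpos s hs]
    have hsT : HasDerivAt (fun s : ℝ => s * T) T s := by simpa using (hasDerivAt_id s).mul_const T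
    refine (((hsT.const_add 1).log h₁).sub ((hsT.const_sub 1).log h₂)).congr_deriv ?_
    rw [div_sub_div _ _ h₁ h₂]
    congr 1 <;> ring
  · refine ContinuousOn.intervalIntegrable_of_Icc zero_le_one ?_
    fun_prop (disch := assumption)

theorem dist_normalCurve_le (hJ : D.Swaps v₁ v₂) (horth : v₁ ⟂ v₂) {K : Z} {η x₀ : V} {t₀ T : ℝ}
    (hη : η ∈ v₂) (hx₀ : x₀ ∈ v₁) (ht₀ : 0 < t₀) (hT₀ : 0 ≤ T) (hT : T < 1)
    (hnorm : ‖η‖ ^ 2 = 4 * t₀ * (T ^ 2 - ‖K‖ ^ 2)) :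
    D.dist (D.normalCurve K η x₀ t₀ T 1) (D.normalCurve K η x₀ t₀ T 0) ≤
      Real.log (1 + T) - Real.log (1 - T) := by
  have hpos : ∀ s ∈ Set.Icc (0 : ℝ) 1, 0 < 1 - (1 - s) ^ 2 * T ^ 2 := fun s hs => by
    have h₁ : 0 ≤ (1 - s) * T := mul_nonneg (by linarith [hs.2]) hT₀
    have h₂ : (1 - s) * T < 1 := by nlinarith [hs.1]
    nlinarith
  -- The curve is run backwards, from the given point to the slice, so that symmetry of the distance
  -- is not needed.
  have hγ : IsCurve fun s => D.normalCurve K η x₀ t₀ T (1 - s) := by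
    refine ⟨((contDiff_normalCurve D K η x₀ t₀ T).comp
      (contDiff_const.sub contDiff_id)).contDiffOn, fun s hs => ?_⟩
    exact div_pos (mul_pos ht₀ (hpos s hs)) (by positivity)
  have h := D.dist_le_curveLength hγ
  simp only [sub_zero, sub_self] at h
  refine h.trans_eq ?_
  have hint := intervalIntegral.integral_comp_sub_left (a := 0) (b := 1)
    (fun s : ℝ => 2 * T / (1 - s ^ 2 * T ^ 2)) 1
  rw [sub_zero, sub_self, integral_two_mul_div_one_sub_sq hT₀ hT] at hint
  rw [← hint, Riem.curveLength]
  refine intervalIntegral.integral_congr fun s hs => ?_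
  rw [Set.uIcc_of_le zero_le_one] at hs
  have hd : derivWithin (fun s => D.normalCurve K η x₀ t₀ T (1 - s)) (Set.Icc 0 1) s =
      -D.normalCurveVelocity K η x₀ t₀ T (1 - s) :=
    ((hasDerivAt_normalCurve D K η x₀ t₀ T (1 - s)).comp_const_sub 1 s).hasDerivWithinAt.derivWithin
      (uniqueDiffOn_Icc one_pos s hs)
  have hneg : ∀ p X : V × Z × ℝ, D.metric p (-X) (-X) = D.metric p X X := fun p X => by
    rw [← metricForm_apply, ← metricForm_apply, map_neg, map_neg, LinearMap.neg_apply, neg_neg]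
  have hp := hpos s hs
  simp only [hd, hneg, metric_normalCurveVelocity hJ horth hη hx₀ ht₀ hnorm hp]
  exact Real.sqrt_sq (by positivity)

/-- Every point is joined to `{(v, 0, t) : v ∈ v₁}` by a curve of the length `arcosh √F`. -/
theorem exists_dist_le (hJ : D.Swaps v₁ v₂) (horth : v₁ ⟂ v₂) (hsum : v₁ ⊔ v₂ = ⊤)
    {p : V × Z × ℝ} (hp : p ∈ halfSpace V Z) {r : ℝ} (hr : 0 ≤ r)
    (hF : D.quarticF v₁ v₂ p = Real.cosh r ^ 2) : ∃ q ∈ slice Z v₁, D.dist p q ≤ r := by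
  have hp' : 0 < p.2.2 := hp
  -- T = tanh(r/2), so the curve has length 2 artanh T = r.
  set T := (Real.exp r - 1) / (Real.exp r + 1) with hTdef
  have hE : 1 ≤ Real.exp r := Real.one_le_exp hr
  have hT₀ : 0 ≤ T := div_nonneg (by linarith) (by linarith)
  have hT : T < 1 := (div_lt_one (by linarith)).2 (by linarith)
  have hT2 : 0 < 1 - T ^ 2 := by nlinarith
  have hcosh : Real.cosh r = (1 + T ^ 2) / (1 - T ^ 2) := by
    have h1 : 1 - T ^ 2 = 4 * Real.exp r / (Real.exp r + 1) ^ 2 := by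
      rw [hTdef]; field_simp; ring
    have h2 : 1 + T ^ 2 = 2 * (Real.exp r ^ 2 + 1) / (Real.exp r + 1) ^ 2 := by
      rw [hTdef]; field_simp; ring
    rw [h1, h2, Real.cosh_eq, Real.exp_neg]
    field_simp
    ring
  have hlog : Real.log (1 + T) - Real.log (1 - T) = r := by
    rw [← Real.log_div (by linarith) (by linarith)]
    have : (1 + T) / (1 - T) = Real.exp r := by
      rw [div_eq_iff (by linarith), hTdef]; field_simp; ring
    rw [this, Real.log_exp]
  set x := v₁.starProjection p.1 with hx
  set y := v₂.starProjection p.1 with hy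
  have hxm : x ∈ v₁ := v₁.starProjection_apply_mem _
  have hym : y ∈ v₂ := v₂.starProjection_apply_mem _
  set A := quarticA v₂ p with hA
  set B := D.quarticB v₁ v₂ p with hB
  have hApos : 0 < A := by rw [hA, quarticA]; positivity
  have hyn : ‖y‖ ^ 2 = 2 * (A - p.2.2) := by rw [hA, quarticA]; ring
  -- W = t cosh r, so the hypothesis on F reads A² + ‖B‖² = W².
  set W := p.2.2 * ((1 + T ^ 2) / (1 - T ^ 2)) with hW
  have hWpos : 0 < W := by positivity
  have hAB : A ^ 2 + ‖B‖ ^ 2 = W ^ 2 := by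
    rw [quarticF_eq, div_eq_iff (by positivity), hcosh] at hF
    rw [hF, hW]; ring
  -- The parameters come from requiring that the curve reach p at s = 1. The V- and height
  -- components give η = (1 + ‖K‖²)y, x₀ = x - J_K y and t₀ = t(1 + ‖K‖²)/(1 - T²). The Z-component
  -- becomes B = (2t/(1 - T²) + ½‖y‖²)K = (A + W)K.
  set K := (A + W)⁻¹ • B with hK
  have hBK : B = (A + W) • K := by rw [hK, smul_smul, mul_inv_cancel₀ (by positivity), one_smul]
  have hKn : ‖K‖ ^ 2 = (W - A) / (W + A) := by
    have h : ‖B‖ ^ 2 = (A + W) ^ 2 * ‖K‖ ^ 2 := by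
      rw [hBK, norm_smul, mul_pow, Real.norm_of_nonneg (by positivity)]
    rw [h] at hAB
    rw [eq_div_iff (by positivity)]
    apply mul_left_cancel₀ (show A + W ≠ 0 by positivity)
    linarith
  have hx₀ : x - D.J K y ∈ v₁ := v₁.sub_mem hxm (hJ.2 _ _ hym)
  set t₀ := p.2.2 * (1 + ‖K‖ ^ 2) / (1 - T ^ 2) with ht₀
  have ht₀pos : 0 < t₀ := by positivity
  have hnorm : ‖(1 + ‖K‖ ^ 2) • y‖ ^ 2 = 4 * t₀ * (T ^ 2 - ‖K‖ ^ 2) := by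
    rw [norm_smul, Real.norm_of_nonneg (by positivity), mul_pow, hyn, ht₀, hKn, hW]
    field_simp
    ring
  have hq0 : (1 + ‖K‖ ^ 2) ≠ 0 := by positivity
  have hend : D.normalCurve K ((1 + ‖K‖ ^ 2) • y) (x - D.J K y) t₀ T 1 = p := by
    have hd := horth.starProjection_add_starProjection hsum p.1
    rw [← hx, ← hy] at hd
    refine Prod.ext ?_ (Prod.ext ?_ ?_)
    · conv_rhs => rw [← hd]
      simp only [normalCurve, one_pow, one_mul, map_smul, smul_smul, one_div,
        inv_mul_cancel₀ hq0, one_smul]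
      abel
    · have hz : p.2.1 = B + (1 / 2 : ℝ) • D.bracket x y := by
        rw [hB, quarticB, sub_add_cancel]
      have hAW : A + W = 2 * p.2.2 / (1 - T ^ 2) + 1 / 2 * ‖y‖ ^ 2 := by
        rw [hyn, hW]; field_simp; ring
      rw [hz, hBK, hAW]
      simp only [normalCurve, one_pow, one_mul, sub_eq_add_neg x, bracket_add_left,
        bracket_smul_right, ← neg_one_smul ℝ (D.J K y), bracket_smul_left, bracket_J_self]
      rw [ht₀]
      match_scalars
      · field_simp
      · field_simp
    · simp only [normalCurve, one_pow, one_mul]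
      rw [ht₀]
      field_simp
  refine ⟨D.normalCurve K ((1 + ‖K‖ ^ 2) • y) (x - D.J K y) t₀ T 0, ⟨?_, ?_, ?_⟩, ?_⟩
  · simpa [halfSpace, normalCurve] using ht₀pos
  · simpa [normalCurve] using hx₀
  · simp [normalCurve]
  · have h := dist_normalCurve_le hJ horth (v₂.smul_mem (1 + ‖K‖ ^ 2) hym) hx₀ ht₀pos hT₀ hT hnorm
    rwa [hend, hlog] at h

theorem quarticF_of_mem_slice (horth : v₁ ⟂ v₂) {q : V × Z × ℝ} (hq : q ∈ slice Z v₁) :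
    D.quarticF v₁ v₂ q = 1 := by
  obtain ⟨hq₀, hq₁, hq₂⟩ := hq
  have h0 : q.2.2 ≠ 0 := (show 0 < q.2.2 from hq₀).ne'
  simp [quarticF, horth.symm.starProjection_eq_zero hq₁, hq₂, bracket_zero_right, h0]

/-- The Lipschitz bound holds for every point of the slice, and the foot of the explicit normal
curve attains it. -/
theorem sInf_dist_slice (hJ : D.Swaps v₁ v₂) (horth : v₁ ⟂ v₂) (hsum : v₁ ⊔ v₂ = ⊤)
    {p : V × Z × ℝ} (hp : p ∈ halfSpace V Z) :
    sInf ((fun q => Riem.dist D.metric (halfSpace V Z) p q) '' slice Z v₁) =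
      Real.arsinh √(D.quarticF v₁ v₂ p - 1) := by
  have hF := one_le_quarticF (D := D) (v₁ := v₁) (v₂ := v₂) hp
  obtain ⟨q, hq, hpq⟩ := exists_dist_le hJ horth hsum hp
    (r := Real.arsinh √(D.quarticF v₁ v₂ p - 1)) (Real.arsinh_nonneg_iff.2 (Real.sqrt_nonneg _))
    (by rw [Real.cosh_sq, Real.sinh_arsinh, Real.sq_sqrt (by linarith)]; ring)
  have hlow : ∀ d ∈ (fun q => Riem.dist D.metric (halfSpace V Z) p q) '' slice Z v₁,
      Real.arsinh √(D.quarticF v₁ v₂ p - 1) ≤ d := by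
    rintro _ ⟨q, hq, rfl⟩
    refine D.le_dist hp hq.1 fun γ hγ h0 h1 => ?_
    rw [← h0]
    exact arsinh_le_curveLength hJ horth hsum hγ (by rw [h1, quarticF_of_mem_slice horth hq])
  exact le_antisymm ((csInf_le ⟨_, hlow⟩ ⟨q, hq, rfl⟩).trans hpq) (le_csInf ⟨_, q, hq, rfl⟩ hlow)

theorem level_eq_tube (hJ : D.Swaps v₁ v₂) (horth : v₁ ⟂ v₂) (hsum : v₁ ⊔ v₂ = ⊤)
    {r : ℝ} (hr : 0 ≤ r) :
    {p ∈ halfSpace V Z | D.quarticF v₁ v₂ p = Real.cosh r ^ 2} = D.tube (slice Z v₁) r := by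
  ext p
  refine and_congr_right fun hp => ?_
  rw [sInf_dist_slice hJ horth hsum hp]
  have hF := one_le_quarticF (D := D) (v₁ := v₁) (v₂ := v₂) hp
  constructor
  · intro h
    rw [h, Real.cosh_sq, add_sub_cancel_right, Real.sqrt_sq (Real.sinh_nonneg_iff.2 hr),
      Real.arsinh_sinh]
  · intro h
    rw [← h, Real.cosh_sq, Real.sinh_arsinh, Real.sq_sqrt (by linarith)]
    ring

end DamekRicci

end

theorem proposition6p4 {V Z : Type*}
    [NormedAddCommGroup V] [InnerProductSpace ℝ V] [FiniteDimensional ℝ V]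
    [NormedAddCommGroup Z] [InnerProductSpace ℝ Z] [FiniteDimensional ℝ Z]
    (D : DamekRicci V Z) (v₁ v₂ : Submodule ℝ V) (horth : v₁ ⟂ v₂) (hsum : v₁ ⊔ v₂ = ⊤) :
    (D.IsTransnormal (D.quarticF v₁ v₂) ↔
      (∀ z : Z, ∀ v ∈ v₁, D.J z v ∈ v₂) ∧ (∀ z : Z, ∀ v ∈ v₂, D.J z v ∈ v₁)) ∧
    (Module.finrank ℝ Z ≠ 0 → (Module.finrank ℝ V ≠ 0 ∨ Module.finrank ℝ Z = 1) →
      (D.IsIsoparametric (D.quarticF v₁ v₂) ↔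
        ∃ k : ℕ, 1 ≤ k ∧ ∃ e : D.Iso (DamekRicci.complexHyperbolic k),
          DamekRicci.IsMaximalTotallyReal e v₁)) ∧
    (∀ k : ℕ, 1 ≤ k → ∀ e : D.Iso (DamekRicci.complexHyperbolic k),
      DamekRicci.IsMaximalTotallyReal e v₁ →
        D.IsRealHyperbolicSubspace k (DamekRicci.slice Z v₁) ∧
        (∀ p ∈ DamekRicci.halfSpace V Z, 1 ≤ D.quarticF v₁ v₂ p) ∧
        ∀ r : ℝ, 0 ≤ r →
          {p ∈ DamekRicci.halfSpace V Z | D.quarticF v₁ v₂ p = Real.cosh r ^ 2} =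
            D.tube (DamekRicci.slice Z v₁) r) := by
  refine ⟨⟨DamekRicci.swaps_of_isTransnormal horth hsum,
    fun hJ => DamekRicci.isTransnormal_of_swaps hJ horth hsum⟩,
    DamekRicci.isIsoparametric_iff horth hsum, fun k _ e he => ?_⟩
  have hJ := DamekRicci.swaps_of_isMaximalTotallyReal horth hsum e he
  exact ⟨DamekRicci.isRealHyperbolicSubspace_slice hJ horth
      (DamekRicci.finrank_of_isMaximalTotallyReal horth hsum e he),
    fun p hp => DamekRicci.one_le_quarticF hp,
    fun r hr => DamekRicci.level_eq_tube hJ horth hsum hr⟩
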